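/- Let $T$ be a finite tree of order $n$ and let $2\le k\le n$. The Steiner distance $\mathsf d(S)$ of a set $S\subseteq V(T)$ is the least number of edges of a connected subgraph of $T$ containing $S$; the Steiner $k$-distance of a vertex $v$ is $\mathsf d_k(v)=\sum_{S\subseteq V(T),\,|S|=k-1,\,v\notin S}\mathsf d(\{v\}\cup S)$; and a Steiner $k$-centroid is a vertex with minimal Steiner $k$-distance. For integers $a,b\ge -1$ with $a+b\ge 0$ put $$F(a,b)=(k-2)\binom{a+b+2}{k}-(k-2-b)\binom{b+1}{k-1}-(k-2-a)\binom{a+1}{k-1}-(k-1)\binom{b+1}{k}-(k-1)\binom{a+1}{k}+\binom{a+b}{k-2}.$$ Consider the ratio $\mathsf d_k(w)/\mathsf d_k(v)$ over all trees $T$ of order $n$, all leaves $w$ of $T$ and all Steiner $k$-centroids $v$ of $T$. The following lower bounds hold. 1. If $k=n$, then $\dfrac{\mathsf d_k(w)}{\mathsf d_k(v)}\ge 1+\dfrac{\binom{n-2}{k-1}}{n-1}$; if $k=n-1$, then $\dfrac{\mathsf d_k(w)}{\mathsf d_k(v)}\ge 1+\dfrac{\binom{n-2}{k-1}}{2(n-2)+(n-3)(n-1)}$.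 For $k\ge n-1$ the ratio is minimized by the path of length $n-1$ with $w$ an end vertex and $v$ the vertex adjacent to $w$ (which is a Steiner $k$-centroid), and the corresponding bound is attained there. 2. If $n$ is even and $k\le \frac n2+1$, then $\dfrac{\mathsf d_k(w)}{\mathsf d_k(v)}\ge 1+\dfrac{\binom{n-2}{k-1}}{F\left(\frac n2,\frac n2-2\right)}$. If moreover $k<n$, the ratio is minimized, with equality in this bound, by the tree consisting of a path of length $n-2$, a vertex $v$ on it at distance $\frac n2$ from an end vertex of the path, and a further vertex $w$ adjacent to $v$ only. 3. If $n$ is odd and $k\le \frac n2+1$, then $\dfrac{\mathsf d_k(w)}{\mathsf d_k(v)}\ge 1+\dfrac{\binom{n-2}{k-1}}{F\left(\frac{n-1}2,\frac{n-3}2\right)}$. If moreover $k<n$ (which is automatic), the ratio is minimized, with equality in this bound, by the tree consisting of a path of length $n-2$, a vertex $v$ on it at distance $\frac{n-1}2$ from an end vertex of the path, and a further vertex $w$ adjacent to $v$ only. 4. If $k>\frac n2+1$, then $\dfrac{\mathsf d_k(w)}{\mathsf d_k(v)}\ge 1+\dfrac{\binom{n-2}{k-1}}{F(k-1,\,n-k-1)}$.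 If moreover $k<n$, the ratio is minimized, with equality in this bound, by the tree consisting of a path of length $n-2$, a vertex $v$ on it at distance $k-1$ from an end vertex of the path, and a further vertex $w$ adjacent to $v$ only. In each case with $k<n$ the minimizing graph is unique: if a tree $T$ of order $n$ with a leaf $w$ and a Steiner $k$-centroid $v$ attains the minimum, then there is an isomorphism from $T$ to the described tree that maps $w$ to the described leaf. -/

import Mathlib

universe u

/-- The Steiner distance of a set `S` of vertices: the least number of edges of a connected
subgraph of `G` containing `S`. -/
noncomputable def steinerDist {V : Type*} (G : SimpleGraph V) (S : Set V) : ℕ :=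
  sInf {m : ℕ | ∃ H : G.Subgraph, H.Connected ∧ S ⊆ H.verts ∧ H.edgeSet.ncard = m}

open Classical in
/-- The Steiner `k`-distance of `v`: the sum of the Steiner distances of `{v} ∪ S` over all sets
`S` of `k - 1` vertices not containing `v`. -/
noncomputable def steinerKDist {V : Type*} [Fintype V] (G : SimpleGraph V) (k : ℕ) (v : V) : ℕ :=
  ∑ S ∈ (Finset.univ : Finset (Finset V)) with S.card = k - 1 ∧ v ∉ S,
    steinerDist G ({v} ∪ (S : Set V))

/-- `v` is a Steiner `k`-centroid: a vertex of minimal Steiner `k`-distance. -/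
def IsSteinerCentroid {V : Type*} [Fintype V] (G : SimpleGraph V) (k : ℕ) (v : V) : Prop :=
  ∀ u : V, steinerKDist G k v ≤ steinerKDist G k u

/-- `w` is a leaf: it has exactly one neighbour. -/
def IsLeafVertex {V : Type*} (G : SimpleGraph V) (w : V) : Prop :=
  ∃! u : V, G.Adj w u

/-- `T` is a tree, `w` is a leaf of `T` and `v` is a Steiner `k`-centroid of `T`. -/
structure IsLeafCentroidTree {V : Type*} [Fintype V] (T : SimpleGraph V) (k : ℕ) (w v : V) :
    Prop where
  isTree : T.IsTree
  isLeaf : IsLeafVertex T w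
  isCentroid : IsSteinerCentroid T k v

/-- The ratio `d_k(w) / d_k(v)`. -/
noncomputable def steinerRatio {V : Type*} [Fintype V] (G : SimpleGraph V) (k : ℕ) (w v : V) : ℝ :=
  (steinerKDist G k w : ℝ) / (steinerKDist G k v : ℝ)

/-- `c` is a lower bound for the ratio `d_k(w) / d_k(v)` over all trees of order `n`, all leaves
`w` and all Steiner `k`-centroids `v`. -/
def IsRatioLowerBound (n k : ℕ) (c : ℝ) : Prop :=
  ∀ (V : Type u) [Fintype V] (T : SimpleGraph V) (w v : V),
    Fintype.card V = n → IsLeafCentroidTree T k w v → c ≤ steinerRatio T k w v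

/-- `E`, with the leaf `w₀` and the Steiner `k`-centroid `v₀`, minimizes `d_k(w) / d_k(v)` among
all trees of the same order with a leaf `w` and a Steiner `k`-centroid `v`. -/
def IsRatioMinimizer {X : Type} [Fintype X] (E : SimpleGraph X) (k : ℕ) (w₀ v₀ : X) : Prop :=
  IsLeafCentroidTree E k w₀ v₀ ∧
    IsRatioLowerBound.{u} (Fintype.card X) k (steinerRatio E k w₀ v₀)

/-- `E`, with the leaf `w₀` and the Steiner `k`-centroid `v₀`, minimizes `d_k(w) / d_k(v)`, and
every minimizing tree is isomorphic to `E`, with its leaf corresponding to `w₀`. (All Steiner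
`k`-centroids of a tree give the same ratio, so the centroid itself need not correspond.) -/
def IsUniqueRatioMinimizer {X : Type} [Fintype X] (E : SimpleGraph X) (k : ℕ) (w₀ v₀ : X) :
    Prop :=
  IsRatioMinimizer.{u} E k w₀ v₀ ∧
    ∀ (V : Type u) [Fintype V] (T : SimpleGraph V) (w v : V),
      Fintype.card V = Fintype.card X → IsLeafCentroidTree T k w v →
        steinerRatio T k w v = steinerRatio E k w₀ v₀ → ∃ φ : T ≃g E, φ w = w₀

/-- The path on the `m` vertices `some 0, …, some (m - 1)`, together with one further vertex `none`
that is adjacent to `some p` only; here `some p` has distance `p` from the end `some 0`. -/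
def pendantPath (m : ℕ) (p : Fin m) : SimpleGraph (Option (Fin m)) :=
  (SimpleGraph.pathGraph m).map Function.Embedding.some ⊔ SimpleGraph.edge none (some p)

/-- The function `F(a, b)` (for the given `k`); it is used for `a, b ≥ -1` with `a + b ≥ 0` and
`k ≥ 2` only, where all the binomial coefficients have nonnegative integer entries. -/
def steinerF (k : ℕ) (a b : ℤ) : ℤ :=
  ((k : ℤ) - 2) * ((b + a + 2).toNat.choose k : ℤ)
    - ((k : ℤ) - 2 - b) * ((b + 1).toNat.choose (k - 1) : ℤ)
    - ((k : ℤ) - 2 - a) * ((a + 1).toNat.choose (k - 1) : ℤ)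
    - ((k : ℤ) - 1) * ((b + 1).toNat.choose k : ℤ)
    - ((k : ℤ) - 1) * ((a + 1).toNat.choose k : ℤ)
    + ((a + b).toNat.choose (k - 2) : ℤ)

/-! Root the tree at v and let B(u) consist of u and all vertices that u separates from v. The
Steiner tree of {v} ∪ S has one edge for each u ≠ v whose B(u) meets S. So d_k(v) is the sum over u
≠ v of W(|B(u)|), where W(m) counts the (k-1)-subsets of an (n-1)-set that meet a given m-set
(`IsTree.steinerKDist_eq`). Crossing an edge with m vertices on its far side changes d_k by the gain
g(m) = C(n-1-m, k-1) - C(m-1, k-1). It is nonincreasing in m, and nonnegative exactly for m ≤ M =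
max(⌊n/2⌋, k-1). Hence v is a centroid iff |B(u)| ≤ M for all u ≠ v.

Let k < n and b = n-2-M. All centroids have the same d_k, so v may be taken as the one nearest to w;
then all gains on the way to w are positive. Deleting w from the sets B(u) leaves a laminar family
on n-2 vertices with members of size at most M. For every i it has at most as many members of size
above i as two chains of lengths M and b (`card_large_laminar_le`). Summing over i bounds d_k(v) by
F(M, b), up to a correction for each u strictly between v and w, whose B(u) contained w. On the
other side, d_k(w) - d_k(v) is C(n-2, k-1), the gain of the last edge, plus the gains at these same
u. Each such gain outweighs the matching correction (`choose_lt_steinerGain`), so the ratio is at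
least 1 + C(n-2, k-1)/F(M, b) (`IsTree.leaf_dist_bound`).

Equality forces w to be adjacent to v and the counts to agree for all i ≤ n-k, which is enough to
identify the two paths (`IsTree.exists_two_paths`). The cases of the theorem are the possible values
of M. For k = n all d_k equal n-1 and every ratio is 1. -/

namespace SimpleGraph

/-! ### Geodesics and branches in a tree -/

open Finset

variable {V : Type*} {T : SimpleGraph V}

/-- `b` lies on a geodesic from `a` to `c`. -/
def GeodBetween (G : SimpleGraph V) (a b c : V) : Prop :=
  G.dist a c = G.dist a b + G.dist b c

lemma GeodBetween.symm {a b c : V} (h : T.GeodBetween a b c) : T.GeodBetween c b a := by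
  unfold GeodBetween at *
  rw [T.dist_comm (u := c) (v := a), T.dist_comm (u := c) (v := b), T.dist_comm (u := b) (v := a), h,
    add_comm]

@[simp] lemma geodBetween_left (a c : V) : T.GeodBetween a a c := by simp [GeodBetween]

@[simp] lemma geodBetween_right (a c : V) : T.GeodBetween a c c := by simp [GeodBetween]

lemma Connected.geodBetween_self_iff (hT : T.Connected) {a b : V} :
    T.GeodBetween a b a ↔ b = a := by
  have h : T.dist a b = 0 ↔ a = b := hT.dist_eq_zero_iff
  have h' : T.dist b a = T.dist a b := T.dist_comm
  constructor
  · intro hb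
    unfold GeodBetween at hb
    rw [dist_self] at hb
    exact (h.1 (by omega)).symm
  · rintro rfl; simp

lemma Connected.geodBetween_trans (hT : T.Connected) {v x u z : V} (h₁ : T.GeodBetween v u x)
    (h₂ : T.GeodBetween v x z) : T.GeodBetween v u z ∧ T.GeodBetween u x z := by
  have t₁ : T.dist v z ≤ T.dist v u + T.dist u z := hT.dist_triangle
  have t₂ : T.dist u z ≤ T.dist u x + T.dist x z := hT.dist_triangle
  unfold GeodBetween at *
  omega

lemma Connected.geodBetween_antisymm (hT : T.Connected) {v x u : V} (h₁ : T.GeodBetween v u x)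
    (h₂ : T.GeodBetween v x u) : u = x := by
  have h : T.dist u x = 0 ↔ u = x := hT.dist_eq_zero_iff
  have h' : T.dist x u = T.dist u x := T.dist_comm
  unfold GeodBetween at *
  exact h.1 (by omega)

lemma IsTree.length_eq_dist (hT : T.IsTree) {a b : V} {p : T.Walk a b} (hp : p.IsPath) :
    p.length = T.dist a b := by
  obtain ⟨q, hq, hl⟩ := hT.connected.exists_path_of_dist a b
  rw [(hT.existsUnique_path a b).unique hp hq, hl]

lemma IsTree.geodBetween_of_mem_support (hT : T.IsTree) {a b c : V} {p : T.Walk a c}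
    (hp : p.IsPath) (hb : b ∈ p.support) : T.GeodBetween a b c := by
  classical
  have h₁ := hT.length_eq_dist (hp.takeUntil hb)
  have h₂ := hT.length_eq_dist (hp.dropUntil hb)
  have h₃ := hT.length_eq_dist hp
  have h₄ := congrArg Walk.length (p.take_spec hb)
  rw [Walk.length_append] at h₄
  unfold GeodBetween
  omega

/-- Geodesics from `a` to `b` and from `b` to `c` concatenate to the unique path, which every walk
from `a` to `c` contains after its detours are removed. -/
lemma IsTree.mem_support_of_geodBetween (hT : T.IsTree) {a b c : V} (h : T.GeodBetween a b c)
    (q : T.Walk a c) : b ∈ q.support := by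
  classical
  obtain ⟨p₁, -, h₁⟩ := hT.connected.exists_path_of_dist a b
  obtain ⟨p₂, -, h₂⟩ := hT.connected.exists_path_of_dist b c
  have hp : (p₁.append p₂).IsPath := by
    apply Walk.isPath_of_length_eq_dist
    rw [Walk.length_append, h₁, h₂, h]
  have hq := (hT.existsUnique_path a c).unique hp q.bypass_isPath
  apply q.support_bypass_subset_support
  rw [← hq, Walk.mem_support_append_iff]
  simp

/-- Both vertices lie on the one path from `v` to `z`. This is what makes the branches at `v`
laminar. -/
lemma IsTree.geodBetween_comparable (hT : T.IsTree) {v x y z : V} (hx : T.GeodBetween v x z)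
    (hy : T.GeodBetween v y z) : T.GeodBetween v x y ∨ T.GeodBetween v y x := by
  classical
  obtain ⟨p, hp, -⟩ := hT.connected.exists_path_of_dist v z
  have hxp := hT.mem_support_of_geodBetween hx p
  have hyp := hT.mem_support_of_geodBetween hy p
  rw [← p.take_spec hyp, Walk.mem_support_append_iff] at hxp
  rcases hxp with h | h
  · exact .inl (hT.geodBetween_of_mem_support (hp.takeUntil hyp) h)
  · have h := hT.geodBetween_of_mem_support (hp.dropUntil hyp) h
    right
    unfold GeodBetween at *
    omega

lemma IsTree.geodBetween_or_of_adj (hT : T.IsTree) {v x : V} (h : T.Adj v x) (z : V) :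
    T.GeodBetween v x z ∨ T.GeodBetween x v z := by
  have h₁ : T.dist v x = 1 := dist_eq_one_iff_adj.2 h
  have h₂ : T.dist x v = 1 := dist_eq_one_iff_adj.2 h.symm
  have h₃ := hT.dist_eq_dist_add_one_of_adj z h
  rw [T.dist_comm (u := z) (v := v), T.dist_comm (u := z) (v := x)] at h₃
  unfold GeodBetween
  omega

lemma Connected.exists_adj_geodBetween (hT : T.Connected) {v z : V} (h : v ≠ z) :
    ∃ c, T.Adj v c ∧ T.GeodBetween v c z := by
  obtain ⟨p, -, hl⟩ := hT.exists_path_of_dist v z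
  cases p with
  | nil => exact absurd rfl h
  | @cons _ c _ hadj q =>
    refine ⟨c, hadj, ?_⟩
    have h₁ : T.dist v c = 1 := dist_eq_one_iff_adj.2 hadj
    have h₂ := dist_le q
    have h₃ : T.dist v z ≤ T.dist v c + T.dist c z := hT.dist_triangle
    rw [Walk.length_cons] at hl
    unfold GeodBetween
    omega

/-- Induction on the distance from `v` to `p`, removing the first edge `v v'`. If that edge led away
from `z`, then `v` and `w` would be comparable on the geodesic from `v'` to `z`, which contradicts
that `v'` lies between `v` and `w`. -/
lemma IsTree.geodBetween_append (hT : T.IsTree) {v p w z : V} (h : T.Adj p w)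
    (h₁ : T.GeodBetween v p w) (h₂ : T.GeodBetween p w z) : T.GeodBetween v w z := by
  induction hd : T.dist v p generalizing v with
  | zero =>
    rw [hT.connected.dist_eq_zero_iff] at hd
    subst hd
    exact h₂
  | succ d ih =>
    have hne : v ≠ p := by rintro rfl; simp at hd
    obtain ⟨v', ha, hb⟩ := hT.connected.exists_adj_geodBetween hne
    obtain ⟨hb', h₁'⟩ := hT.connected.geodBetween_trans hb h₁
    have hvv : T.dist v v' = 1 := dist_eq_one_iff_adj.2 ha
    have hpw : T.dist p w = 1 := dist_eq_one_iff_adj.2 h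
    have hih := ih h₁' (by unfold GeodBetween at hb; omega)
    rcases hT.geodBetween_or_of_adj ha z with h' | h'
    · unfold GeodBetween at *; omega
    · exfalso
      have hc : T.dist v' v = T.dist v v' := T.dist_comm
      have hc' : T.dist w v = T.dist v w := T.dist_comm
      rcases hT.geodBetween_comparable h' hih with h'' | h'' <;> unfold GeodBetween at * <;> omega

lemma IsTree.eq_or_geodBetween_of_adj (hT : T.IsTree) {v p w u : V} (h : T.Adj p w)
    (hp : T.GeodBetween v p w) (hu : T.GeodBetween v u w) : u = w ∨ T.GeodBetween v u p := by
  rcases hT.geodBetween_comparable hp hu with h' | h'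
  · have h₁ : T.dist p w = 1 := dist_eq_one_iff_adj.2 h
    have h₂ : T.dist p u = 0 ↔ p = u := hT.connected.dist_eq_zero_iff
    have h₃ : T.dist u w = 0 ↔ u = w := hT.connected.dist_eq_zero_iff
    by_cases hpu : p = u
    · right; rw [← hpu]; simp
    · left
      have : T.dist p u ≠ 0 := fun h => hpu (h₂.1 h)
      unfold GeodBetween at *
      exact h₃.1 (by omega)
  · exact .inr h'

lemma IsTree.geodBetween_of_adj_root (hT : T.IsTree) {v c u z : V} (h : T.Adj v c) (hu : u ≠ v)
    (hc : T.GeodBetween v c z) (huz : T.GeodBetween v u z) : T.GeodBetween v c u := by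
  rcases hT.geodBetween_comparable hc huz with h' | h'
  · exact h'
  · have h₁ : T.dist v c = 1 := dist_eq_one_iff_adj.2 h
    have h₂ : T.dist v u ≠ 0 := fun h0 => hu (hT.connected.dist_eq_zero_iff.1 h0).symm
    have h₃ : T.dist u c = 0 := by unfold GeodBetween at h'; omega
    rw [hT.connected.dist_eq_zero_iff.1 h₃]
    simp

variable [Fintype V]

open Classical in
/-- The set of the vertices separated from the root `v` by `u`, together with `u`. -/
noncomputable def branch (G : SimpleGraph V) (v u : V) : Finset V :=
  univ.filter fun z => G.GeodBetween v u z

@[simp] lemma mem_branch {v u z : V} : z ∈ T.branch v u ↔ T.GeodBetween v u z := by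
  simp [branch]

lemma self_mem_branch (v u : V) : u ∈ T.branch v u := by simp

lemma card_branch_pos (v u : V) : 0 < #(T.branch v u) := card_pos.2 ⟨u, self_mem_branch v u⟩

lemma Connected.branch_subset (hT : T.Connected) {v x u : V} (h : x ∈ T.branch v u) :
    T.branch v x ⊆ T.branch v u := by
  intro z hz
  rw [mem_branch] at *
  exact (hT.geodBetween_trans h hz).1

lemma Connected.root_notMem_branch (hT : T.Connected) {v u : V} (h : u ≠ v) :
    v ∉ T.branch v u := by
  rw [mem_branch, hT.geodBetween_self_iff]
  exact h

lemma Connected.card_branch_lt (hT : T.Connected) {v u : V} (h : u ≠ v) :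
    #(T.branch v u) < Fintype.card V := by
  classical
  rw [← card_univ]
  exact card_lt_card (ssubset_univ_iff.2 fun h' => hT.root_notMem_branch h (h' ▸ mem_univ v))

/-- The component cut off at a third vertex does not depend on which end of the edge is the root. So
moving the root along an edge alters only two summands of the branch formula. -/
lemma IsTree.branch_eq_of_adj (hT : T.IsTree) {v x u : V} (h : T.Adj v x) (hv : u ≠ v)
    (hx : u ≠ x) : T.branch x u = T.branch v u := by
  have key : ∀ {v x : V}, T.Adj v x → u ≠ v → u ≠ x → T.branch v u ⊆ T.branch x u := by
    intro v x h hv hx z hz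
    rw [mem_branch] at *
    have h₁ : T.dist v x = 1 := dist_eq_one_iff_adj.2 h
    have h₂ : T.dist x v = T.dist v x := T.dist_comm
    have h₃ : T.dist v u ≠ 0 := fun h0 => hv ((hT.connected.dist_eq_zero_iff.1 h0).symm)
    have h₄ : T.dist x u ≠ 0 := fun h0 => hx ((hT.connected.dist_eq_zero_iff.1 h0).symm)
    have h₅ : T.dist u x = T.dist x u := T.dist_comm
    rcases hT.geodBetween_or_of_adj h z with h' | h'
    · rcases hT.geodBetween_comparable h' hz with h'' | h'' <;> unfold GeodBetween at * <;> omega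
    · rcases hT.geodBetween_or_of_adj h u with h'' | h''
      · have := (hT.connected.geodBetween_trans h'' hz).1
        unfold GeodBetween at *; omega
      · unfold GeodBetween at *; omega
  exact Subset.antisymm (key h.symm hx hv) (key h hv hx)

open Classical in
lemma IsTree.branch_eq_compl_of_adj (hT : T.IsTree) {v x : V} (h : T.Adj v x) :
    T.branch x v = (T.branch v x)ᶜ := by
  ext z
  rw [mem_compl, mem_branch, mem_branch]
  have h₁ : T.dist v x = 1 := dist_eq_one_iff_adj.2 h
  have h₂ : T.dist x v = T.dist v x := T.dist_comm
  have := hT.geodBetween_or_of_adj h z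
  unfold GeodBetween at *
  omega

lemma IsTree.branch_eq_of_geodBetween (hT : T.IsTree) {v p w : V} (h : T.Adj p w)
    (hp : T.GeodBetween v p w) : T.branch p w = T.branch v w := by
  ext z
  rw [mem_branch, mem_branch]
  refine ⟨hT.geodBetween_append h hp, fun hz => (hT.connected.geodBetween_trans hp hz).2⟩

end SimpleGraph

/-! ### Steiner distance in a tree -/

namespace SimpleGraph

open Finset

variable {V : Type*} {T : SimpleGraph V}

lemma Subgraph.ncard_edgeSet (H : T.Subgraph) : H.edgeSet.ncard = Nat.card H.coe.edgeSet := by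
  rw [← Subgraph.image_coe_edgeSet_coe,
    Set.ncard_image_of_injective _ (Sym2.map.injective Subtype.val_injective), Nat.card_coe_set_eq]

lemma IsTree.mem_verts_of_geodBetween (hT : T.IsTree) {H : T.Subgraph} (hH : H.Connected)
    {v u z : V} (hv : v ∈ H.verts) (hz : z ∈ H.verts) (h : T.GeodBetween v u z) :
    u ∈ H.verts := by
  obtain ⟨p, hp⟩ := ((Subgraph.connected_iff_forall_exists_walk_subgraph H).1 hH).2 hv hz
  exact hp.1 ((Walk.mem_verts_toSubgraph p).2 (hT.mem_support_of_geodBetween h p))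

variable [Fintype V]

-- The union of the geodesics from `v` to `S` is the smallest connected subgraph: any other contains
-- these geodesics, and a connected graph has at least as many edges as it has vertices other than
-- `v`. The union itself is a tree, where this is an equality.
open Classical in
lemma IsTree.steinerDist_insert (hT : T.IsTree) (v : V) (S : Set V) :
    steinerDist T ({v} ∪ S) = #{u | u ≠ v ∧ ∃ s ∈ S, T.GeodBetween v u s} := by
  set F : Finset V := {u | u ≠ v ∧ ∃ s ∈ S, T.GeodBetween v u s} with hF
  have hvF : v ∉ F := by simp [hF]
  set A : Set V := ↑(insert v F) with hA
  have hAcard : Nat.card A = #F + 1 := by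
    rw [hA, Nat.card_coe_set_eq, Set.ncard_coe_finset, card_insert_of_notMem hvF]
  have hlow : ∀ H : T.Subgraph, H.Connected → {v} ∪ S ⊆ H.verts → #F ≤ H.edgeSet.ncard := by
    intro H hH hS
    have h₁ := hH.coe.card_vert_le_card_edgeSet_add_one
    rw [← Subgraph.ncard_edgeSet] at h₁
    have hsub : A ⊆ H.verts := by
      intro u hu
      have hv : v ∈ H.verts := hS (by simp)
      simp only [hA, hF, coe_insert, coe_filter, mem_univ, true_and, Set.mem_insert_iff,
        Set.mem_ofPred_eq] at hu
      rcases hu with rfl | ⟨-, s, hs, hb⟩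
      · exact hv
      · exact hT.mem_verts_of_geodBetween hH hv (hS (by simp [hs])) hb
    have h₂ := Nat.card_mono (Set.toFinite _) hsub
    omega
  -- `A` is closed under stepping towards `v`, so induction on the distance joins each of its points
  -- to `v`.
  have hconn : (T.induce A).Connected := by
    have hvA : v ∈ A := by simp [hA]
    rw [connected_iff_exists_forall_reachable]
    refine ⟨⟨v, hvA⟩, ?_⟩
    rintro ⟨u, hu⟩
    induction hd : T.dist v u generalizing u with
    | zero =>
      rw [hT.connected.dist_eq_zero_iff] at hd
      subst hd
      rfl
    | succ d ih =>
      have hne : u ≠ v := by rintro rfl; simp at hd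
      obtain ⟨c, hadj, hb⟩ := hT.connected.exists_adj_geodBetween hne
      have hcA : c ∈ A := by
        by_cases hcv : c = v
        · rwa [hcv]
        · simp only [hA, hF, coe_insert, coe_filter, mem_univ, true_and, Set.mem_insert_iff,
            Set.mem_ofPred_eq, hne, hcv, false_or, ne_eq, not_false_eq_true] at hu ⊢
          obtain ⟨s, hs, h⟩ := hu
          exact ⟨s, hs, (hT.connected.geodBetween_trans hb.symm h).1⟩
      have h₁ : T.dist u c = 1 := dist_eq_one_iff_adj.2 hadj
      have h₂ := hb.symm
      have h₃ : T.dist c u = T.dist u c := T.dist_comm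
      refine (ih c hcA (by unfold GeodBetween at h₂; omega)).trans (Adj.reachable ?_)
      exact hadj.symm
  have hmem : #F ∈ {m : ℕ | ∃ H : T.Subgraph, H.Connected ∧ {v} ∪ S ⊆ H.verts ∧
      H.edgeSet.ncard = m} := by
    refine ⟨(⊤ : T.Subgraph).induce A, ⟨?_⟩, ?_, ?_⟩
    · rw [← induce_eq_coe_induce_top]
      exact hconn
    · rintro s (hs | hs)
      · simp_all
      · by_cases hsv : s = v
        · simp [hA, hsv]
        · simp only [Subgraph.induce_verts, hA, hF, coe_insert, coe_filter, mem_univ, true_and,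
            Set.mem_insert_iff, Set.mem_ofPred_eq]
          exact .inr ⟨hsv, s, hs, geodBetween_right _ _⟩
    · have htree : (T.induce A).IsTree := ⟨hconn, hT.isAcyclic.induce A⟩
      have h := (isTree_iff_connected_and_card.1 htree).2
      rw [hAcard] at h
      rw [Subgraph.ncard_edgeSet, ← induce_eq_coe_induce_top]
      exact Nat.add_right_cancel h
  apply le_antisymm (Nat.sInf_le hmem)
  obtain ⟨H, h₁, h₂, h₃⟩ := Nat.sInf_mem ⟨_, hmem⟩
  exact (hlow H h₁ h₂).trans h₃.le

end SimpleGraph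

/-! ### The branch formula for the Steiner `k`-distance -/

/-- The number of `(k - 1)`-subsets of an `(n - 1)`-set that meet a given `m`-subset. -/
def steinerWeight (n k m : ℕ) : ℕ := ∑ i ∈ Finset.range m, (n - 2 - i).choose (k - 2)

/-- Pascal's rule telescopes: the subsets that meet the `m`-set and those that avoid it are all the
subsets. -/
lemma steinerWeight_add_choose {n k m : ℕ} (hk : 2 ≤ k) (hm : m + 1 ≤ n) :
    steinerWeight n k m + (n - 1 - m).choose (k - 1) = (n - 1).choose (k - 1) := by
  induction m with
  | zero => simp [steinerWeight]
  | succ m ih =>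
    rw [← ih (by omega), steinerWeight, Finset.sum_range_succ, ← steinerWeight]
    obtain ⟨k, rfl⟩ := Nat.exists_eq_add_of_le hk
    obtain ⟨n, rfl⟩ := Nat.exists_eq_add_of_le hm
    have h₁ : m + 1 + 1 + n - 2 - m = n := by omega
    have h₂ : m + 1 + 1 + n - 1 - (m + 1) = n := by omega
    have h₃ : m + 1 + 1 + n - 1 - m = n + 1 := by omega
    have h₄ : 2 + k - 2 = k := by omega
    have h₅ : 2 + k - 1 = k + 1 := by omega
    rw [h₁, h₂, h₃, h₄, h₅, Nat.choose_succ_succ]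
    ring

open Finset in
lemma card_filter_powersetCard_meeting {α : Type*} [DecidableEq α] {s t : Finset α} (h : t ⊆ s)
    (j : ℕ) :
    #{S ∈ s.powersetCard j | ∃ x ∈ S, x ∈ t} + (#s - #t).choose j = (#s).choose j := by
  rw [← card_sdiff_of_subset h, ← card_powersetCard, ← card_powersetCard,
    ← card_filter_add_card_filter_not (s := s.powersetCard j) (fun S => ∃ x ∈ S, x ∈ t)]
  congr 2
  ext S
  simp only [mem_powersetCard, mem_filter, subset_sdiff, not_exists, not_and, disjoint_left]
  tauto

namespace SimpleGraph

open Finset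

variable {V : Type*} {T : SimpleGraph V} [Fintype V]

-- Double counting: `u` contributes to the Steiner distance of `{v} ∪ S` exactly when `S` meets the
-- branch of `u`, a set that avoids `v`.
open Classical in
lemma IsTree.steinerKDist_eq (hT : T.IsTree) {k : ℕ} (hk : 2 ≤ k) (v : V) :
    steinerKDist T k v = ∑ u with u ≠ v, steinerWeight (Fintype.card V) k #(T.branch v u) := by
  have hset : ({S : Finset V | S.card = k - 1 ∧ v ∉ S} : Finset (Finset V)) =
      (univ.erase v).powersetCard (k - 1) := by
    ext S
    simp only [mem_filter, mem_univ, true_and, mem_powersetCard, subset_erase, subset_univ]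
    tauto
  have hcard : #(univ.erase v) = Fintype.card V - 1 := by
    rw [card_erase_of_mem (mem_univ v), card_univ]
  unfold steinerKDist
  rw [hset]
  simp_rw [hT.steinerDist_insert, mem_coe, ← filter_filter, card_filter (fun u => ∃ s ∈ _, _)]
  rw [sum_comm]
  refine sum_congr rfl fun u hu => ?_
  simp only [mem_filter, mem_univ, true_and] at hu
  rw [← card_filter]
  have hsub : T.branch v u ⊆ univ.erase v := by
    rw [subset_erase]
    exact ⟨subset_univ _, hT.connected.root_notMem_branch hu⟩
  have h₁ := card_filter_powersetCard_meeting hsub (k - 1)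
  rw [hcard] at h₁
  have h₂ := steinerWeight_add_choose (n := Fintype.card V) (m := #(T.branch v u)) hk
    (hT.connected.card_branch_lt hu)
  simp only [mem_branch] at h₁
  omega

end SimpleGraph

/-! ### Arithmetic of weights, gains and `steinerF` -/

/-- The sum of the first `a` values `steinerWeight n k 1, …, steinerWeight n k a`: the
contribution of a path of `a` vertices that hangs at the root. -/
def steinerWeightSum (n k a : ℕ) : ℕ := ∑ j ∈ Finset.range a, steinerWeight n k (j + 1)

/-- The increase of the Steiner `k`-distance along an edge with `m` vertices on its far side. -/
def steinerGain (n k m : ℕ) : ℤ := ((n - 1 - m).choose (k - 1) : ℤ) - ((m - 1).choose (k - 1) : ℤ)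

lemma steinerWeight_one (n k : ℕ) : steinerWeight n k 1 = (n - 2).choose (k - 2) := by
  simp [steinerWeight]

lemma steinerWeight_mono {n k m m' : ℕ} (h : m ≤ m') :
    steinerWeight n k m ≤ steinerWeight n k m' :=
  Finset.sum_le_sum_of_subset (Finset.range_mono h)

lemma steinerWeight_sub {n k m : ℕ} (hk : 2 ≤ k) (h₀ : 0 < m) (hm : m < n) :
    (steinerWeight n k (n - m) : ℤ) - steinerWeight n k m = steinerGain n k m := by
  have h₁ := steinerWeight_add_choose (n := n) (k := k) (m := m) hk (by omega)
  have h₂ := steinerWeight_add_choose (n := n) (k := k) (m := n - m) hk (by omega)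
  rw [show n - 1 - (n - m) = m - 1 by omega] at h₂
  unfold steinerGain
  omega

lemma steinerGain_one {n k : ℕ} (hk : 2 ≤ k) : steinerGain n k 1 = (n - 2).choose (k - 1) := by
  rw [steinerGain, Nat.sub_self, Nat.choose_eq_zero_of_lt (n := 0) (by omega), Nat.sub_sub]
  simp

lemma steinerGain_antitone {n k m m' : ℕ} (h : m ≤ m') : steinerGain n k m' ≤ steinerGain n k m := by
  have h₁ := Nat.choose_le_choose (k - 1) (show n - 1 - m' ≤ n - 1 - m by omega)
  have h₂ := Nat.choose_le_choose (k - 1) (show m - 1 ≤ m' - 1 by omega)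
  unfold steinerGain
  omega

lemma Nat.choose_lt_choose_of_lt {a b j : ℕ} (h : a < b) (hj : 0 < j) (hb : j ≤ b) :
    a.choose j < b.choose j := by
  obtain ⟨j, rfl⟩ := Nat.exists_eq_add_of_lt hj
  obtain ⟨b, rfl⟩ := Nat.exists_eq_add_of_le' (Nat.one_le_of_lt h)
  rw [zero_add] at *
  have h₁ := Nat.choose_le_choose (j + 1) (show a ≤ b by omega)
  have h₂ := Nat.choose_pos (show j ≤ b by omega)
  rw [Nat.choose_succ_succ, Nat.succ_eq_add_one]
  omega

/-- For `m ≤ n / 2` the first binomial has the larger upper entry; for `m ≤ k - 1` the second one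
vanishes; beyond both the second is strictly larger. This is where the threshold on `k` in the
theorem comes from. -/
lemma steinerGain_nonneg_iff {n k m : ℕ} (hk : 2 ≤ k) :
    0 ≤ steinerGain n k m ↔ m ≤ max (n / 2) (k - 1) := by
  unfold steinerGain
  constructor
  · intro h
    by_contra! hm
    have := Nat.choose_lt_choose_of_lt (a := n - 1 - m) (b := m - 1) (j := k - 1) (by omega)
      (by omega) (by omega)
    omega
  · intro h
    by_cases hm : m ≤ n / 2
    · have := Nat.choose_le_choose (k - 1) (show m - 1 ≤ n - 1 - m by omega)
      omega
    · rw [Nat.choose_eq_zero_of_lt (show m - 1 < k - 1 by omega)]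
      simp

lemma steinerWeightSum_add_choose {n k a : ℕ} (hk : 2 ≤ k) (ha : a + 1 ≤ n) :
    steinerWeightSum n k a + (n - 1).choose k =
      a * (n - 1).choose (k - 1) + (n - 1 - a).choose k := by
  induction a with
  | zero => simp [steinerWeightSum]
  | succ a ih =>
    have ih := ih (by omega)
    have h := steinerWeight_add_choose (n := n) (k := k) (m := a + 1) hk (by omega)
    rw [steinerWeightSum, Finset.sum_range_succ, ← steinerWeightSum]
    obtain ⟨k, rfl⟩ := Nat.exists_eq_add_of_le' (Nat.one_le_of_lt hk)
    have h₁ : n - 1 - a = n - 1 - (a + 1) + 1 := by omega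
    rw [h₁, Nat.choose_succ_succ (n - 1 - (a + 1)) k] at ih
    rw [Nat.add_sub_cancel] at *
    rw [Nat.succ_eq_add_one] at ih
    linarith

/-- The right side is the Steiner `k`-distance of a vertex that carries one leaf and two paths of
`a` and `b` vertices. -/
lemma steinerF_eq {n k a b : ℕ} (hk : 2 ≤ k) (h : a + b + 2 = n) :
    steinerF k a b = (n - 2).choose (k - 2) + steinerWeightSum n k a + steinerWeightSum n k b := by
  have ha := steinerWeightSum_add_choose (n := n) (k := k) (a := a) hk (by omega)
  have hb := steinerWeightSum_add_choose (n := n) (k := k) (a := b) hk (by omega)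
  obtain ⟨k, rfl⟩ := Nat.exists_eq_add_of_le' hk
  have e₁ : ((b : ℤ) + a + 2).toNat = n := by omega
  have e₂ : ((a : ℤ) + 1).toNat = a + 1 := by omega
  have e₃ : ((b : ℤ) + 1).toNat = b + 1 := by omega
  have e₄ : ((a : ℤ) + b).toNat = n - 2 := by omega
  have e₅ : k + 2 - 1 = k + 1 := by omega
  have e₆ : n - 1 - a = b + 1 := by omega
  have e₇ : n - 1 - b = a + 1 := by omega
  rw [steinerF, e₁, e₂, e₃, e₄, Nat.add_sub_cancel, e₅]
  rw [e₅, e₆] at ha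
  rw [e₅, e₇] at hb
  have pn : n.choose (k + 2) = (n - 1).choose (k + 1) + (n - 1).choose (k + 2) := by
    obtain ⟨n, rfl⟩ := Nat.exists_eq_add_of_le' (show 1 ≤ n by omega)
    rw [Nat.add_sub_cancel, Nat.choose_succ_succ]
  -- Absorption turns the linear coefficients of `steinerF` into binomials. Over the integers it
  -- also holds for `m ≤ k`, where both binomials vanish.
  have key : ∀ m : ℕ, (m.choose (k + 2) : ℤ) * (k + 2) = m.choose (k + 1) * (m - (k + 1)) := by
    intro m
    have := Nat.choose_succ_right_eq m (k + 1)
    by_cases hm : k + 1 ≤ m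
    · zify [hm] at this
      linarith
    · rw [Nat.choose_eq_zero_of_lt (show m < k + 1 by omega),
        Nat.choose_eq_zero_of_lt (show m < k + 2 by omega)]
      simp
  have k₁ := key (n - 1)
  have k₂ := key (a + 1)
  have k₃ := key (b + 1)
  have hn : ((n - 1 : ℕ) : ℤ) = a + b + 1 := by omega
  rw [hn] at k₁
  zify at ha hb pn
  rw [pn]
  push_cast at *
  linear_combination -ha - hb + k₁ - k₂ - k₃

/-! ### Layer counting and laminar families -/

-- Writing each weight as a sum of its increments reduces a comparison of weight sums to a
-- comparison, for each `i`, of the numbers of members of size above `i`.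
open Finset in
lemma sum_steinerWeight_eq {α : Type*} {n k : ℕ} (A : Finset α) (f : α → ℕ)
    (hf : ∀ u ∈ A, f u ≤ n) :
    ∑ u ∈ A, steinerWeight n k (f u) =
      ∑ i ∈ range n, #{u ∈ A | i < f u} * (n - 2 - i).choose (k - 2) := by
  simp_rw [card_filter, sum_mul]
  rw [sum_comm]
  refine sum_congr rfl fun u hu => ?_
  simp_rw [ite_mul, one_mul, zero_mul]
  rw [← sum_filter, steinerWeight]
  refine sum_congr ?_ fun _ _ => rfl
  have := hf u hu
  ext i
  simp only [mem_range, mem_filter]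
  omega

open Finset in
lemma steinerWeightSum_eq {n k a : ℕ} (ha : a ≤ n) :
    steinerWeightSum n k a = ∑ i ∈ range n, (a - i) * (n - 2 - i).choose (k - 2) := by
  rw [steinerWeightSum, sum_steinerWeight_eq (range a) (fun j => j + 1)
    (fun j hj => by rw [mem_range] at hj; omega)]
  refine sum_congr rfl fun i _ => ?_
  congr 1
  have : ({j ∈ range a | i < j + 1} : Finset ℕ) = Ico i a := by
    ext j
    simp only [mem_filter, mem_range, mem_Ico]
    omega
  rw [this, Nat.card_Ico]

/-- In a laminar family, the members of size more than `i` lie on one chain, or two disjoint members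
of size more than `i` contain no other such members. -/
lemma card_large_laminar {α : Type*} [DecidableEq α] {A : Finset α} {D : α → Finset α}
    (hsub : ∀ u ∈ A, D u ⊆ A) (hself : ∀ u ∈ A, u ∈ D u)
    (htrans : ∀ u ∈ A, ∀ x ∈ D u, D x ⊆ D u)
    (hanti : ∀ u ∈ A, ∀ x ∈ A, x ∈ D u → u ∈ D x → x = u)
    (hlam : ∀ x ∈ A, ∀ y ∈ A, ∀ z, z ∈ D x → z ∈ D y → x ∈ D y ∨ y ∈ D x) (i : ℕ) :
    {u ∈ A | i < (D u).card} = ∅ ∨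
    (∃ u ∈ A, {u ∈ A | i < (D u).card}.card + i ≤ (D u).card) ∨
    (2 ≤ {u ∈ A | i < (D u).card}.card ∧ {u ∈ A | i < (D u).card}.card + 2 * i ≤ A.card) := by
  classical
  set S := {u ∈ A | i < (D u).card} with hS
  have hSA : ∀ {u}, u ∈ S → u ∈ A := fun h => (Finset.mem_filter.1 h).1
  rcases S.eq_empty_or_nonempty with h₀ | hne
  · exact .inl h₀
  right
  -- Below a minimal large member `x` there are at least `i` points outside `S`: another large `z ∈
  -- D x` would have `D z = D x`, against antisymmetry.
  have hmin : ∀ x ∈ S, (∀ z ∈ S, z ∈ D x → (D x).card ≤ (D z).card) →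
      ∃ R ⊆ D x, Disjoint S R ∧ i ≤ R.card := by
    intro x hx hm
    refine ⟨(D x).erase x, Finset.erase_subset _ _, ?_, ?_⟩
    · rw [Finset.disjoint_left]
      intro z hz hzx
      rw [Finset.mem_erase] at hzx
      have heq := Finset.eq_of_subset_of_card_le (htrans x (hSA hx) z hzx.2) (hm z hz hzx.2)
      exact hzx.1 (hanti x (hSA hx) z (hSA hz) hzx.2 (heq ▸ hself x (hSA hx)))
    · rw [Finset.card_erase_of_mem (hself x (hSA hx))]
      have := (Finset.mem_filter.1 hx).2
      omega
  obtain ⟨x, hx, hxmin⟩ := S.exists_min_image (fun u => (D u).card) hne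
  obtain ⟨R, hR, hdis, hRc⟩ := hmin x hx fun z hz _ => hxmin z hz
  -- If all large members contain `x`, they form a chain, and the largest contains both `S` and the
  -- `i` points of `R`.
  by_cases hall : ∀ u ∈ S, x ∈ D u
  · left
    obtain ⟨u, hu, humax⟩ := S.exists_max_image (fun u => (D u).card) hne
    have hsub' : S ⊆ D u := by
      intro s hs
      rcases hlam s (hSA hs) u (hSA hu) x (hall s hs) (hall u hu) with h | h
      · exact h
      · have heq := Finset.eq_of_subset_of_card_le (htrans s (hSA hs) u h) (humax s hs)
        exact heq ▸ hself s (hSA hs)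
    refine ⟨u, hSA hu, ?_⟩
    have := Finset.card_le_card (Finset.union_subset hsub'
      (hR.trans (htrans u (hSA hu) x (hall u hu))))
    rw [Finset.card_union_of_disjoint hdis] at this
    omega
  · right
    push Not at hall
    obtain ⟨y₀, hy₀, hxy₀⟩ := hall
    -- A minimal large member that misses `x` is disjoint from `D x` by laminarity, and so supplies
    -- `i` further points outside `S`.
    obtain ⟨y, hy, hymin⟩ := {u ∈ S | x ∉ D u}.exists_min_image (fun u => (D u).card)
      ⟨y₀, Finset.mem_filter.2 ⟨hy₀, hxy₀⟩⟩
    rw [Finset.mem_filter] at hy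
    obtain ⟨R', hR', hdis', hRc'⟩ := hmin y hy.1 fun z hz hzy =>
      hymin z (Finset.mem_filter.2 ⟨hz, fun h => hy.2 (htrans y (hSA hy.1) z hzy h)⟩)
    have hyx : y ∉ D x := by
      intro h
      have heq := Finset.eq_of_subset_of_card_le (htrans x (hSA hx) y h) (hxmin y hy.1)
      exact hy.2 (heq ▸ hself x (hSA hx))
    have hRR : Disjoint R R' := by
      rw [Finset.disjoint_left]
      intro z hz hz'
      rcases hlam x (hSA hx) y (hSA hy.1) z (hR hz) (hR' hz') with h | h
      · exact hy.2 h
      · exact hyx h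
    constructor
    · have hxy : x ≠ y := by
        rintro rfl
        exact hyx (hself x (hSA hx))
      rw [← Finset.card_pair hxy]
      exact Finset.card_le_card (by
        intro z hz
        rw [Finset.mem_insert, Finset.mem_singleton] at hz
        rcases hz with rfl | rfl
        exacts [hx, hy.1])
    · have hdis₂ : Disjoint S (R ∪ R') := by
        rw [Finset.disjoint_union_right]
        exact ⟨hdis, hdis'⟩
      have := Finset.card_le_card (Finset.union_subset (fun z hz => hSA hz)
        (Finset.union_subset (hR.trans (hsub x (hSA hx))) (hR'.trans (hsub y (hSA hy.1)))) :
        S ∪ (R ∪ R') ⊆ A)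
      rw [Finset.card_union_of_disjoint hdis₂, Finset.card_union_of_disjoint hRR] at this
      omega

/-- A laminar family on `M + b` points with members of size at most `M` has at most as many members
of size more than `i` as two chains of `M` and `b` members. -/
lemma card_large_laminar_le {α : Type*} [DecidableEq α] {A : Finset α} {D : α → Finset α}
    (hsub : ∀ u ∈ A, D u ⊆ A) (hself : ∀ u ∈ A, u ∈ D u)
    (htrans : ∀ u ∈ A, ∀ x ∈ D u, D x ⊆ D u)
    (hanti : ∀ u ∈ A, ∀ x ∈ A, x ∈ D u → u ∈ D x → x = u)
    (hlam : ∀ x ∈ A, ∀ y ∈ A, ∀ z, z ∈ D x → z ∈ D y → x ∈ D y ∨ y ∈ D x)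
    {M b : ℕ} (hM : ∀ u ∈ A, (D u).card ≤ M) (hA : A.card = M + b) (i : ℕ) :
    {u ∈ A | i < (D u).card}.card ≤ (M - i) + (b - i) := by
  rcases card_large_laminar hsub hself htrans hanti hlam i with h | ⟨u, hu, h⟩ | ⟨h₁, h₂⟩
  · simp [h]
  · have := hM u hu
    omega
  · obtain ⟨u, hu⟩ := Finset.card_pos.1 (zero_lt_two.trans_le h₁)
    rw [Finset.mem_filter] at hu
    have := hM u hu.1
    omega

/-! ### Change of the Steiner `k`-distance, centroids, and deletion of the leaf -/

namespace SimpleGraph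

open Finset

variable {V : Type*} {T : SimpleGraph V} [Fintype V]

/-- Only the summands of the two ends differ, and the branch of `v` seen from `x` is the complement
of the branch of `x` seen from `v`. -/
lemma IsTree.steinerKDist_sub_of_adj (hT : T.IsTree) {k : ℕ} (hk : 2 ≤ k) {v x : V}
    (h : T.Adj v x) :
    (steinerKDist T k x : ℤ) - steinerKDist T k v =
      steinerGain (Fintype.card V) k #(T.branch v x) := by
  classical
  have h₁ : ({u | u ≠ v} : Finset V) = insert x ({u | u ≠ v ∧ u ≠ x} : Finset V) := by
    ext u
    have := h.ne
    simp only [mem_filter, mem_univ, true_and, mem_insert]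
    grind
  have h₂ : ({u | u ≠ x} : Finset V) = insert v ({u | u ≠ v ∧ u ≠ x} : Finset V) := by
    ext u
    have := h.ne
    simp only [mem_filter, mem_univ, true_and, mem_insert]
    grind
  rw [hT.steinerKDist_eq hk, hT.steinerKDist_eq hk, h₁, h₂, sum_insert (by simp),
    sum_insert (by simp), hT.branch_eq_compl_of_adj h, card_compl,
    sum_congr rfl fun u hu => by
      rw [hT.branch_eq_of_adj h (mem_filter.1 hu).2.1 (mem_filter.1 hu).2.2],
    ← steinerWeight_sub hk (card_branch_pos v x) (hT.connected.card_branch_lt h.ne')]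
  push_cast
  ring

open Classical in
/-- The vertices other than `v` on the path from `v` to `w`. -/
noncomputable def pathVerts (G : SimpleGraph V) (v w : V) : Finset V :=
  {u | u ≠ v ∧ G.GeodBetween v u w}

@[simp] lemma mem_pathVerts {v w u : V} :
    u ∈ T.pathVerts v w ↔ u ≠ v ∧ T.GeodBetween v u w := by
  simp [pathVerts]

lemma IsTree.pathVerts_of_adj [DecidableEq V] (hT : T.IsTree) {v p w : V} (h : T.Adj p w)
    (hp : T.GeodBetween v p w) : T.pathVerts v w = insert w (T.pathVerts v p) := by
  have hwv : w ≠ v := by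
    rintro rfl
    exact h.ne (hT.connected.geodBetween_self_iff.1 hp)
  ext u
  simp only [mem_pathVerts, mem_insert]
  constructor
  · rintro ⟨h₁, h₂⟩
    rcases hT.eq_or_geodBetween_of_adj h hp h₂ with h₃ | h₃
    exacts [.inl h₃, .inr ⟨h₁, h₃⟩]
  · rintro (rfl | ⟨h₁, h₂⟩)
    · exact ⟨hwv, geodBetween_right _ _⟩
    · exact ⟨h₁, (hT.connected.geodBetween_trans h₂ hp).1⟩

lemma IsTree.notMem_pathVerts_of_adj (hT : T.IsTree) {v p w : V} (h : T.Adj p w)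
    (hp : T.GeodBetween v p w) : w ∉ T.pathVerts v p := by
  rw [mem_pathVerts]
  rintro ⟨-, hw⟩
  exact h.ne (hT.connected.geodBetween_antisymm hp hw)

lemma IsTree.card_pathVerts (hT : T.IsTree) (v w : V) : #(T.pathVerts v w) = T.dist v w := by
  classical
  induction hd : T.dist v w generalizing w with
  | zero =>
    rw [hT.connected.dist_eq_zero_iff] at hd
    subst hd
    rw [card_eq_zero, eq_empty_iff_forall_notMem]
    intro u hu
    rw [mem_pathVerts, hT.connected.geodBetween_self_iff] at hu
    exact hu.1 hu.2
  | succ d ih =>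
    have hne : w ≠ v := by rintro rfl; simp at hd
    obtain ⟨p, hadj, hb⟩ := hT.connected.exists_adj_geodBetween hne
    have h₁ : T.dist p w = 1 := dist_eq_one_iff_adj.2 hadj.symm
    have h₂ := hb.symm
    rw [hT.pathVerts_of_adj hadj.symm h₂, card_insert_of_notMem
      (hT.notMem_pathVerts_of_adj hadj.symm h₂), ih p (by unfold GeodBetween at h₂; omega)]

lemma IsTree.steinerKDist_sub (hT : T.IsTree) {k : ℕ} (hk : 2 ≤ k) (v w : V) :
    (steinerKDist T k w : ℤ) - steinerKDist T k v =
      ∑ u ∈ T.pathVerts v w, steinerGain (Fintype.card V) k #(T.branch v u) := by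
  classical
  induction hd : T.dist v w generalizing w with
  | zero =>
    have h := hT.card_pathVerts v w
    rw [hd, card_eq_zero] at h
    rw [hT.connected.dist_eq_zero_iff] at hd
    subst hd
    simp [h]
  | succ d ih =>
    have hne : w ≠ v := by rintro rfl; simp at hd
    obtain ⟨p, hadj, hb⟩ := hT.connected.exists_adj_geodBetween hne
    have h₁ : T.dist p w = 1 := dist_eq_one_iff_adj.2 hadj.symm
    have h₂ := hb.symm
    rw [hT.pathVerts_of_adj hadj.symm h₂, sum_insert
      (hT.notMem_pathVerts_of_adj hadj.symm h₂), ← ih p (by unfold GeodBetween at h₂; omega),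
      ← hT.branch_eq_of_geodBetween hadj.symm h₂, ← hT.steinerKDist_sub_of_adj hk hadj.symm]
    ring

lemma Connected.exists_adj_mem_branch (hT : T.Connected) {v u : V} (h : u ≠ v) :
    ∃ c, T.Adj v c ∧ u ∈ T.branch v c := by
  simpa using hT.exists_adj_geodBetween h.symm

/-- Comparison with the neighbours suffices: every branch lies in that of a neighbour of `v`, and
nonnegative gains add up along any path from `v`. -/
lemma IsTree.isSteinerCentroid_iff (hT : T.IsTree) {k : ℕ} (hk : 2 ≤ k) (v : V) :
    IsSteinerCentroid T k v ↔
      ∀ u ≠ v, #(T.branch v u) ≤ max (Fintype.card V / 2) (k - 1) := by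
  constructor
  · intro h u hu
    obtain ⟨c, hadj, hc⟩ := hT.connected.exists_adj_mem_branch hu
    have h₁ := hT.steinerKDist_sub_of_adj hk hadj
    have h₂ := h c
    refine (card_le_card (hT.connected.branch_subset hc)).trans
      ((steinerGain_nonneg_iff hk).1 ?_)
    omega
  · intro h u
    have h₁ := hT.steinerKDist_sub hk v u
    have h₂ : 0 ≤ ∑ x ∈ T.pathVerts v u, steinerGain (Fintype.card V) k #(T.branch v x) :=
      sum_nonneg fun x hx => (steinerGain_nonneg_iff hk).2 (h x (mem_pathVerts.1 hx).1)
    omega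

lemma IsTree.branch_leaf (hT : T.IsTree) {v w : V} (hw : IsLeafVertex T w) (hvw : w ≠ v) :
    T.branch v w = {w} := by
  ext z
  rw [mem_branch, mem_singleton]
  refine ⟨fun hz => ?_, fun h => h ▸ geodBetween_right _ _⟩
  by_contra hzw
  obtain ⟨c, hc, hcz⟩ := hT.connected.exists_adj_geodBetween (Ne.symm hzw)
  obtain ⟨c', hc', hcv⟩ := hT.connected.exists_adj_geodBetween hvw
  obtain rfl := hw.unique hc hc'
  have h₁ : T.dist w c = 1 := dist_eq_one_iff_adj.2 hc
  have h₂ : T.dist v z ≤ T.dist v c + T.dist c z := hT.connected.dist_triangle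
  have h₃ := hcv.symm
  have h₄ : T.dist c w = T.dist w c := T.dist_comm
  unfold GeodBetween at *
  omega

open Classical in
/-- The vertices other than `v` and `w`. -/
noncomputable def others (v w : V) : Finset V := {u | u ≠ v ∧ u ≠ w}

@[simp] lemma mem_others {v w u : V} : u ∈ others v w ↔ u ≠ v ∧ u ≠ w := by
  simp [others]

lemma card_others {v w : V} (h : w ≠ v) : #(others v w) + 2 = Fintype.card V := by
  classical
  have : insert v (insert w (others v w)) = univ := by
    ext u
    simp only [mem_insert, mem_others, mem_univ, iff_true]
    tauto
  rw [← card_univ, ← this, card_insert_of_notMem, card_insert_of_notMem] <;> simp [h.symm]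

open Classical in
lemma IsTree.laminar_branch_erase (hT : T.IsTree) (v w : V) :
    (∀ u ∈ others v w, (T.branch v u).erase w ⊆ others v w) ∧
    (∀ u ∈ others v w, u ∈ (T.branch v u).erase w) ∧
    (∀ u ∈ others v w, ∀ x ∈ (T.branch v u).erase w,
      (T.branch v x).erase w ⊆ (T.branch v u).erase w) ∧
    (∀ u ∈ others v w, ∀ x ∈ others v w, x ∈ (T.branch v u).erase w →
      u ∈ (T.branch v x).erase w → x = u) ∧
    (∀ x ∈ others v w, ∀ y ∈ others v w, ∀ z, z ∈ (T.branch v x).erase w →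
      z ∈ (T.branch v y).erase w →
      x ∈ (T.branch v y).erase w ∨ y ∈ (T.branch v x).erase w) := by
  simp only [mem_others, mem_erase, subset_iff, mem_branch]
  refine ⟨?_, ?_, ?_, ?_, ?_⟩
  · rintro u ⟨hu, -⟩ x ⟨hx, hx'⟩
    refine ⟨?_, hx⟩
    rintro rfl
    exact hu (hT.connected.geodBetween_self_iff.1 hx')
  · rintro u ⟨-, hu⟩
    exact ⟨hu, geodBetween_right _ _⟩
  · rintro u - x ⟨-, hx⟩ z ⟨hz, hz'⟩
    exact ⟨hz, (hT.connected.geodBetween_trans hx hz').1⟩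
  · rintro u - x - ⟨-, h⟩ ⟨-, h'⟩
    exact hT.connected.geodBetween_antisymm h' h
  · rintro x ⟨-, hx⟩ y ⟨-, hy⟩ z ⟨-, h⟩ ⟨-, h'⟩
    rcases hT.geodBetween_comparable h h' with h | h
    exacts [.inr ⟨hy, h⟩, .inl ⟨hx, h⟩]

open Classical in
lemma IsTree.sum_steinerWeight_erase_le (hT : T.IsTree) {v w : V} (hvw : w ≠ v) {k M b : ℕ} (hM : ∀ u ∈ others v w, #((T.branch v u).erase w) ≤ M)
    (hn : M + b + 2 = Fintype.card V) :
    ∑ u ∈ others v w, steinerWeight (Fintype.card V) k #((T.branch v u).erase w) ≤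
      steinerWeightSum (Fintype.card V) k M + steinerWeightSum (Fintype.card V) k b := by
  obtain ⟨h₁, h₂, h₃, h₄, h₅⟩ := hT.laminar_branch_erase v w
  have hc := card_others hvw
  rw [sum_steinerWeight_eq _ _ fun u _ => card_le_univ _, steinerWeightSum_eq (by omega),
    steinerWeightSum_eq (by omega), ← sum_add_distrib]
  refine sum_le_sum fun i _ => ?_
  rw [← add_mul]
  exact Nat.mul_le_mul_right _ (card_large_laminar_le h₁ h₂ h₃ h₄ h₅ hM (by omega) i)

-- Equality of the sums forces equality in each layer whose coefficient `(n - 2 - i).choose (k - 2)`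
-- is nonzero, that is, for `i ≤ n - k`.
open Classical in
lemma IsTree.card_large_eq (hT : T.IsTree) {v w : V} (hvw : w ≠ v) {k M b : ℕ} (hk : 2 ≤ k) (hM : ∀ u ∈ others v w, #((T.branch v u).erase w) ≤ M)
    (hn : M + b + 2 = Fintype.card V)
    (heq : ∑ u ∈ others v w, steinerWeight (Fintype.card V) k #((T.branch v u).erase w) =
      steinerWeightSum (Fintype.card V) k M + steinerWeightSum (Fintype.card V) k b)
    {i : ℕ} (hi : i + k ≤ Fintype.card V) :
    #{u ∈ others v w | i < #((T.branch v u).erase w)} = (M - i) + (b - i) := by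
  obtain ⟨h₁, h₂, h₃, h₄, h₅⟩ := hT.laminar_branch_erase v w
  have hc := card_others hvw
  rw [sum_steinerWeight_eq _ _ fun u _ => card_le_univ _, steinerWeightSum_eq (by omega),
    steinerWeightSum_eq (by omega), ← sum_add_distrib] at heq
  simp_rw [← add_mul] at heq
  have h := (sum_eq_sum_iff_of_le fun j _ => Nat.mul_le_mul_right _
    (card_large_laminar_le h₁ h₂ h₃ h₄ h₅ hM (by omega) j)).1 heq i (mem_range.2 (by omega))
  exact Nat.eq_of_mul_eq_mul_right (Nat.choose_pos (by omega)) h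

end SimpleGraph

/-! ### The lower bound seen from the nearest centroid -/

lemma steinerWeight_succ (n k m : ℕ) :
    steinerWeight n k (m + 1) = steinerWeight n k m + (n - 1 - (m + 1)).choose (k - 2) := by
  rw [steinerWeight, Finset.sum_range_succ, ← steinerWeight]
  congr 2
  omega

lemma choose_lt_steinerGain {n k m : ℕ} (hk : 2 ≤ k) (hm : 0 < m)
    (h : 0 < steinerGain n k m) :
    ((n - k : ℕ) : ℤ) * (n - 1 - m).choose (k - 2) <
      ((n - 1 : ℕ) : ℤ) * (k - 1 : ℕ) * steinerGain n k m := by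
  have hlt : (m - 1).choose (k - 1) < (n - 1 - m).choose (k - 1) := by
    unfold steinerGain at h
    omega
  have h₁ : k ≤ n - m := by
    by_contra! h'
    rw [Nat.choose_eq_zero_of_lt (n := n - 1 - m) (by omega)] at hlt
    omega
  have h₂ : m - 1 < n - 1 - m := by
    by_contra! h'
    have := Nat.choose_le_choose (k - 1) h'
    omega
  obtain ⟨a, ha⟩ := Nat.exists_eq_add_of_le h₁
  obtain ⟨K, rfl⟩ := Nat.exists_eq_add_of_le' hk
  obtain rfl : n = a + K + 2 + m := by omega
  have e₁ : a + K + 2 + m - 1 - m = a + K + 1 := by omega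
  have e₂ : K + 2 - 1 = K + 1 := by omega
  have e₃ : a + K + 2 + m - (K + 2) = a + m := by omega
  have e₄ : a + K + 2 + m - 1 = a + m + (K + 1) := by omega
  -- Pascal's rule splits the first binomial of the gain, and the second part dominates the
  -- subtracted one, since `m - 1 ≤ n - 2 - m`.
  have hg : ((a + K).choose K : ℤ) ≤ steinerGain (a + K + 2 + m) (K + 2) m := by
    have h₃ := Nat.choose_le_choose (K + 1) (show m - 1 ≤ a + K by omega)
    unfold steinerGain
    rw [e₁, e₂, Nat.choose_succ_succ, Nat.succ_eq_add_one]
    push_cast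
    omega
  have hc := Nat.choose_mul_succ_eq (a + K) K
  rw [show a + K + 1 - K = a + 1 by omega] at hc
  have hpos : 0 < (a + K).choose K := Nat.choose_pos (by omega)
  rw [e₁, e₂, e₃, e₄, Nat.add_sub_cancel]
  refine lt_of_lt_of_le ?_ (mul_le_mul_of_nonneg_left hg (by positivity))
  norm_cast
  refine Nat.lt_of_mul_lt_mul_right (a := a + 1) ?_
  calc (a + m) * (a + K + 1).choose K * (a + 1)
      = (a + m) * ((a + K).choose K * (a + K + 1)) := by rw [hc]; ring
    _ = (a + m) * (a + K + 1) * (a + K).choose K := by ring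
    _ < (a + m + (K + 1)) * ((K + 1) * (a + 1)) * (a + K).choose K := by
        refine Nat.mul_lt_mul_of_pos_right ?_ hpos
        have : a + K + 1 ≤ (K + 1) * (a + 1) := by nlinarith [Nat.zero_le (K * a)]
        exact Nat.mul_lt_mul_of_lt_of_le (by omega) this (by positivity)
    _ = (a + m + (K + 1)) * (K + 1) * (a + K).choose K * (a + 1) := by ring

namespace SimpleGraph

open Finset

variable {V : Type*} {T : SimpleGraph V} [Fintype V]

/-- A gain that vanished on the first edge towards `w` would make the neighbour a centroid nearer to
`w`. Branches shrink along the path, so all later gains are positive as well. -/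
lemma IsTree.exists_nearest_centroid (hT : T.IsTree) {k : ℕ} (hk : 2 ≤ k) {v : V}
    (hv : IsSteinerCentroid T k v) (w : V) :
    ∃ c, IsSteinerCentroid T k c ∧
      ∀ u ∈ T.pathVerts c w, 0 < steinerGain (Fintype.card V) k #(T.branch c u) := by
  classical
  obtain ⟨c, hc, hmin⟩ := exists_min_image {x | IsSteinerCentroid T k x} (fun x => T.dist x w)
    ⟨v, by simpa using hv⟩
  simp only [mem_filter, mem_univ, true_and] at hc hmin
  refine ⟨c, hc, fun u hu => ?_⟩
  rw [mem_pathVerts] at hu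
  obtain ⟨x, hadj, hx⟩ := hT.connected.exists_adj_mem_branch hu.1
  refine lt_of_lt_of_le ?_ (steinerGain_antitone (card_le_card (hT.connected.branch_subset hx)))
  rw [← hT.steinerKDist_sub_of_adj hk hadj]
  by_contra! hle
  have hxc : IsSteinerCentroid T k x := fun y => by
    have := hc y
    omega
  have h₁ := hmin x hxc
  rw [mem_branch] at hx
  have h₂ := (hT.connected.geodBetween_trans hx hu.2).1
  have h₃ : T.dist c x = 1 := dist_eq_one_iff_adj.2 hadj
  unfold GeodBetween at h₂
  omega

lemma IsTree.leaf_ne_centroid (hT : T.IsTree) {k : ℕ} (hk : 2 ≤ k) (hkn : k < Fintype.card V)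
    {v w : V} (hv : IsSteinerCentroid T k v) (hw : IsLeafVertex T w) : w ≠ v := by
  classical
  rintro rfl
  rw [hT.isSteinerCentroid_iff hk] at hv
  obtain ⟨c, hc, huniq⟩ := hw
  have hsub : univ.erase w ⊆ T.branch w c := by
    intro u hu
    rw [mem_erase] at hu
    obtain ⟨x, hx, hux⟩ := hT.connected.exists_adj_mem_branch hu.1
    rwa [huniq x hx] at hux
  have h₁ := card_le_card hsub
  rw [card_erase_of_mem (mem_univ w), card_univ] at h₁
  have h₂ := hv c hc.ne'
  omega

-- Erasing `w` shrinks only the branches of vertices on the path to `w`, each by one point; the last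
-- sum collects the lost increments.
open Classical in
lemma IsTree.steinerKDist_eq_erase (hT : T.IsTree) {k : ℕ} (hk : 2 ≤ k) {v w : V}
    (hw : IsLeafVertex T w) (hvw : w ≠ v) :
    steinerKDist T k v =
      (∑ u ∈ others v w, steinerWeight (Fintype.card V) k #((T.branch v u).erase w) +
        (Fintype.card V - 2).choose (k - 2)) +
      ∑ u ∈ (T.pathVerts v w).erase w,
        (Fintype.card V - 1 - #(T.branch v u)).choose (k - 2) := by
  have h₁ : ({u | u ≠ v} : Finset V) = insert w (others v w) := by
    ext u
    simp only [mem_filter, mem_univ, true_and, mem_insert, mem_others]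
    grind
  have h₂ : (T.pathVerts v w).erase w = {u ∈ others v w | w ∈ T.branch v u} := by
    ext u
    simp only [mem_erase, mem_pathVerts, mem_filter, mem_others, mem_branch]
    tauto
  rw [hT.steinerKDist_eq hk, h₁, sum_insert (by simp), hT.branch_leaf hw hvw, card_singleton,
    steinerWeight_one, h₂, sum_filter]
  have h₃ : ∀ u ∈ others v w, steinerWeight (Fintype.card V) k #(T.branch v u) =
      steinerWeight (Fintype.card V) k #((T.branch v u).erase w) +
        if w ∈ T.branch v u then (Fintype.card V - 1 - #(T.branch v u)).choose (k - 2) else 0 := by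
    intro u _
    split_ifs with h
    · rw [← card_erase_add_one h, steinerWeight_succ]
    · rw [erase_eq_of_notMem h, add_zero]
  rw [sum_congr rfl h₃, sum_add_distrib]
  ring

open Classical in
lemma IsTree.leaf_dist_bound (hT : T.IsTree) {k M b : ℕ} (hk : 2 ≤ k) (hkn : k < Fintype.card V)
    {v w : V} (hw : IsLeafVertex T w) (hvw : w ≠ v) (hM : ∀ u ≠ v, #(T.branch v u) ≤ M)
    (hpos : ∀ u ∈ T.pathVerts v w, 0 < steinerGain (Fintype.card V) k #(T.branch v u))
    (hn : M + b + 2 = Fintype.card V) {F : ℕ}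
    (hF : F = (Fintype.card V - 2).choose (k - 2) + steinerWeightSum (Fintype.card V) k M +
      steinerWeightSum (Fintype.card V) k b) :
    ((Fintype.card V - 2).choose (k - 1) : ℤ) * steinerKDist T k v ≤
      F * ((steinerKDist T k w : ℤ) - steinerKDist T k v) ∧
    (((Fintype.card V - 2).choose (k - 1) : ℤ) * steinerKDist T k v =
        F * ((steinerKDist T k w : ℤ) - steinerKDist T k v) →
      T.Adj v w ∧
      ∑ u ∈ others v w, steinerWeight (Fintype.card V) k #((T.branch v u).erase w) =
        steinerWeightSum (Fintype.card V) k M + steinerWeightSum (Fintype.card V) k b) := by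
  have hMo : ∀ u ∈ others v w, #((T.branch v u).erase w) ≤ M := fun u hu =>
    (card_le_card (erase_subset _ _)).trans (hM u (mem_others.1 hu).1)
  have hsum := hT.sum_steinerWeight_erase_le (k := k) hvw hMo hn
  have hd := hT.steinerKDist_eq_erase hk hw hvw
  have hsub := hT.steinerKDist_sub hk v w
  have hwQ : w ∈ T.pathVerts v w := by simp [hvw]
  rw [← add_sum_erase _ _ hwQ, hT.branch_leaf hw hvw, card_singleton, steinerGain_one hk] at hsub
  -- Each of the `n - 1` summands is at least the weight of a single point, as `u` stays in its own
  -- branch.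
  have hlow : (Fintype.card V - 1) * (Fintype.card V - 2).choose (k - 2) ≤
      ∑ u ∈ others v w, steinerWeight (Fintype.card V) k #((T.branch v u).erase w) +
        (Fintype.card V - 2).choose (k - 2) := by
    have h₁ := card_nsmul_le_sum (others v w)
      (fun u => steinerWeight (Fintype.card V) k #((T.branch v u).erase w))
      ((Fintype.card V - 2).choose (k - 2)) (fun u hu => by
        rw [← steinerWeight_one]
        exact steinerWeight_mono (card_pos.2 ⟨u, by simp [(mem_others.1 hu).2]⟩))
    have h₂ := card_others hvw
    rw [smul_eq_mul] at h₁
    rw [show Fintype.card V - 1 = #(others v w) + 1 by omega, add_mul, one_mul]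
    omega
  set n := Fintype.card V with hn_def
  set D := ∑ u ∈ others v w, steinerWeight n k #((T.branch v u).erase w) + (n - 2).choose (k - 2)
    with hD
  set Q := (T.pathVerts v w).erase w with hQ
  have hh : 0 < (n - 2).choose (k - 1) := Nat.choose_pos (by omega)
  -- The factor `k - 1` turns `(n - 2).choose (k - 1)` into `(n - k) * (n - 2).choose (k - 2)`, so
  -- that `choose_lt_steinerGain` and `hlow` apply. Strictness will force `Q = ∅` when equality
  -- holds.
  have hterm : ∀ u ∈ Q, ((n - 2).choose (k - 1) : ℤ) * ((n - 1 - #(T.branch v u)).choose (k - 2)) <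
      D * steinerGain n k #(T.branch v u) := by
    intro u hu
    have hg := hpos u (mem_of_mem_erase hu)
    have h₁ := choose_lt_steinerGain hk (card_branch_pos v u) hg
    have h₂ : (n - 2).choose (k - 1) * (k - 1) = (n - 2).choose (k - 2) * (n - k) := by
      have := Nat.choose_succ_right_eq (n - 2) (k - 2)
      rwa [show k - 2 + 1 = k - 1 by omega, show n - 2 - (k - 2) = n - k by omega] at this
    have hc : 0 < (n - 2).choose (k - 2) := Nat.choose_pos (by omega)
    have hk1 : (0 : ℤ) < (k - 1 : ℕ) := by omega
    zify at h₂ hlow hc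
    refine lt_of_mul_lt_mul_right ?_ hk1.le
    calc ((n - 2).choose (k - 1) : ℤ) * ((n - 1 - #(T.branch v u)).choose (k - 2)) * (k - 1 : ℕ)
        = ((n - 2).choose (k - 2) : ℤ) *
            (((n - k : ℕ) : ℤ) * (n - 1 - #(T.branch v u)).choose (k - 2)) := by
          linear_combination ((n - 1 - #(T.branch v u)).choose (k - 2) : ℤ) * h₂
      _ < ((n - 2).choose (k - 2) : ℤ) *
            (((n - 1 : ℕ) : ℤ) * (k - 1 : ℕ) * steinerGain n k #(T.branch v u)) :=
          mul_lt_mul_of_pos_left h₁ hc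
      _ = (((n - 1 : ℕ) : ℤ) * (n - 2).choose (k - 2)) *
            (steinerGain n k #(T.branch v u) * (k - 1 : ℕ)) := by ring
      _ ≤ (D : ℤ) * (steinerGain n k #(T.branch v u) * (k - 1 : ℕ)) :=
          mul_le_mul_of_nonneg_right hlow (by positivity)
      _ = _ := by ring
  have hDF : D ≤ F := by omega
  have hGnn : 0 ≤ ∑ u ∈ Q, steinerGain n k #(T.branch v u) :=
    sum_nonneg fun u hu => (hpos u (mem_of_mem_erase hu)).le
  have hle : ((n - 2).choose (k - 1) : ℤ) *
      ∑ u ∈ Q, ((n - 1 - #(T.branch v u)).choose (k - 2) : ℤ) ≤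
      D * ∑ u ∈ Q, steinerGain n k #(T.branch v u) := by
    rw [mul_sum, mul_sum]
    exact sum_le_sum fun u hu => (hterm u hu).le
  zify at hd hDF hh
  rw [hsub, hd]
  have hF' : (D : ℤ) * ((n - 2).choose (k - 1) + ∑ u ∈ Q, steinerGain n k #(T.branch v u)) ≤
      F * ((n - 2).choose (k - 1) + ∑ u ∈ Q, steinerGain n k #(T.branch v u)) :=
    mul_le_mul_of_nonneg_right hDF (by positivity)
  refine ⟨by linarith, fun heq => ?_⟩
  have hDeq : D = F := by
    by_contra hne
    have hlt : (D : ℤ) < F := by omega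
    have := mul_lt_mul_of_pos_right hlt
      (show 0 < (((n - 2).choose (k - 1) : ℤ) + ∑ u ∈ Q, steinerGain n k #(T.branch v u)) by
        positivity)
    linarith
  have hQe : Q = ∅ := by
    by_contra hne
    have : ((n - 2).choose (k - 1) : ℤ) *
        ∑ u ∈ Q, ((n - 1 - #(T.branch v u)).choose (k - 2) : ℤ) <
        D * ∑ u ∈ Q, steinerGain n k #(T.branch v u) := by
      rw [mul_sum, mul_sum]
      exact sum_lt_sum_of_nonempty (nonempty_iff_ne_empty.2 hne) hterm
    linarith
  refine ⟨?_, by omega⟩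
  rw [← dist_eq_one_iff_adj, ← hT.card_pathVerts, ← insert_erase hwQ, ← hQ, hQe]
  simp

/-! ### The case of equality -/

lemma IsTree.dist_le_of_card_branch_le (hT : T.IsTree) {v : V} {M : ℕ}
    (hM : ∀ u ≠ v, #(T.branch v u) ≤ M) (x : V) : T.dist v x ≤ M := by
  by_cases hx : x = v
  · simp [hx]
  obtain ⟨c, hc, hxc⟩ := hT.connected.exists_adj_mem_branch hx
  rw [← hT.card_pathVerts]
  refine (card_le_card fun u hu => ?_).trans (hM c hc.ne')
  rw [mem_pathVerts] at hu
  rw [mem_branch] at *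
  exact hT.geodBetween_of_adj_root hc hu.1 hxc hu.2

open Classical in
/-- If the branches at `v` outside the leaf `w` have the same weight as two paths of `M` and `b`
vertices, then they are two such paths. -/
lemma IsTree.exists_two_paths (hT : T.IsTree) {k M b : ℕ} (hk : 2 ≤ k) (hkn : k < Fintype.card V)
    {v w : V} (hw : IsLeafVertex T w) (hadj : T.Adj v w) (hM : ∀ u ≠ v, #(T.branch v u) ≤ M)
    (hMdef : M = max (Fintype.card V / 2) (k - 1)) (hn : M + b + 2 = Fintype.card V)
    (heq : ∑ u ∈ others v w, steinerWeight (Fintype.card V) k #((T.branch v u).erase w) =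
      steinerWeightSum (Fintype.card V) k M + steinerWeightSum (Fintype.card V) k b) :
    ∃ x y, T.dist v x = M ∧ T.dist v y = b ∧
      ∀ u ≠ w, T.GeodBetween v u x ∨ T.GeodBetween v u y := by
  have hvw : w ≠ v := hadj.ne'
  have hMo : ∀ u ∈ others v w, #((T.branch v u).erase w) ≤ M := fun u hu =>
    (card_le_card (erase_subset _ _)).trans (hM u (mem_others.1 hu).1)
  have hcount := fun i (hi : i + k ≤ Fintype.card V) => hT.card_large_eq hvw hk hMo hn heq hi
  have herase : ∀ u ∈ others v w, (T.branch v u).erase w = T.branch v u := by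
    intro u hu
    rw [erase_eq_of_notMem]
    intro hwu
    rw [mem_others] at hu
    have h₁ : T.dist v w = 1 := dist_eq_one_iff_adj.2 hadj
    have h₂ : T.dist v u ≠ 0 := fun h => hu.1 (hT.connected.dist_eq_zero_iff.1 h).symm
    have h₃ : T.dist u w ≠ 0 := fun h => hu.2 (hT.connected.dist_eq_zero_iff.1 h)
    rw [mem_branch] at hwu
    unfold GeodBetween at hwu
    omega
  have hfilter : ∀ i, ({u ∈ others v w | i < #((T.branch v u).erase w)} : Finset V) =
      {u ∈ others v w | i < #(T.branch v u)} := fun i =>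
    filter_congr fun u hu => by rw [herase u hu]
  have hsubo : ∀ u ∈ others v w, T.branch v u ⊆ others v w := fun u hu =>
    herase u hu ▸ (hT.laminar_branch_erase v w).1 u hu
  have hco := card_others hvw
  -- `L` holds the far ends of the arms. The layer `i = 1`, available because `k < n`, shows that
  -- there are two of them, or one if `b = 0`.
  set L : Finset V := {u ∈ others v w | ¬ 1 < #(T.branch v u)} with hL
  have hLcard : #L + ((M - 1) + (b - 1)) = M + b := by
    have h₁ : #{u ∈ others v w | 1 < #(T.branch v u)} + #L = #(others v w) := by
      rw [hL]
      convert card_filter_add_card_filter_not (s := others v w) (fun u => 1 < #(T.branch v u))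
    rw [← hfilter, hcount 1 (by omega)] at h₁
    omega
  have hdown : ∀ u ∈ others v w, ∃ x ∈ L, x ∈ T.branch v u := by
    intro u hu
    obtain ⟨x, hx, hmin⟩ := exists_min_image (T.branch v u) (fun z => #(T.branch v z))
      ⟨u, self_mem_branch v u⟩
    refine ⟨x, ?_, hx⟩
    rw [hL, mem_filter, not_lt, card_le_one]
    refine ⟨hsubo u hu hx, ?_⟩
    have key : ∀ z ∈ T.branch v x, z = x := by
      intro z hz
      have h₁ := eq_of_subset_of_card_le (hT.connected.branch_subset hz)
        (hmin z (hT.connected.branch_subset hx hz))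
      have h₂ : x ∈ T.branch v z := h₁ ▸ self_mem_branch v x
      rw [mem_branch] at hz h₂
      exact hT.connected.geodBetween_antisymm h₂ hz
    exact fun a ha c hc => (key a ha).trans (key c hc).symm
  have hpath : ∀ x ∈ L, T.pathVerts v x ⊆ others v w := by
    intro x hx u hu
    rw [mem_pathVerts] at hu
    refine mem_others.2 ⟨hu.1, ?_⟩
    rintro rfl
    have h₁ : x ∈ T.branch v u := mem_branch.2 hu.2
    rw [hT.branch_leaf hw hvw, mem_singleton] at h₁
    exact (mem_others.1 (mem_filter.1 hx).1).2 h₁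
  have hcover : ∀ x y, (∀ z ∈ L, z = x ∨ z = y) → ∀ u ≠ w,
      T.GeodBetween v u x ∨ T.GeodBetween v u y := by
    intro x y hxy u hu
    by_cases huv : u = v
    · simp [huv]
    obtain ⟨z, hz, hzu⟩ := hdown u (mem_others.2 ⟨huv, hu⟩)
    rw [mem_branch] at hzu
    rcases hxy z hz with rfl | rfl
    exacts [.inl hzu, .inr hzu]
  have hsubset : ∀ x y, (∀ z ∈ L, z = x ∨ z = y) →
      others v w ⊆ T.pathVerts v x ∪ T.pathVerts v y := by
    intro x y hxy u hu
    rw [mem_others] at hu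
    simp only [mem_union, mem_pathVerts, hu.1, ne_eq, not_false_eq_true, true_and]
    exact hcover x y hxy u hu.2
  rcases Nat.eq_zero_or_pos b with rfl | hb
  · obtain ⟨x, hx⟩ := card_eq_one.1 (show #L = 1 by omega)
    have hxy : ∀ z ∈ L, z = x ∨ z = v := by simp [hx]
    refine ⟨x, v, ?_, dist_self, hcover x v hxy⟩
    have h₁ := card_le_card (hsubset x v hxy)
    have h₂ := card_union_le (T.pathVerts v x) (T.pathVerts v v)
    have h₃ := hT.dist_le_of_card_branch_le hM x
    rw [hT.card_pathVerts, hT.card_pathVerts, dist_self] at h₂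
    omega
  · obtain ⟨x, y, hne, hxyL⟩ := card_eq_two.1 (show #L = 2 by omega)
    have hxy : ∀ z ∈ L, z = x ∨ z = y := by simp [hxyL]
    have hxL : x ∈ L := by simp [hxyL]
    have hyL : y ∈ L := by simp [hxyL]
    -- A common vertex would put all `M + b` vertices into the branch of one neighbour of `v`, which
    -- has at most `M`.
    have hdisj : Disjoint (T.pathVerts v x) (T.pathVerts v y) := by
      rw [Finset.disjoint_left]
      intro z hzx hzy
      rw [mem_pathVerts] at hzx hzy
      obtain ⟨c, hc, hzc⟩ := hT.connected.exists_adj_mem_branch hzx.1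
      rw [mem_branch] at hzc
      have hsub : others v w ⊆ T.branch v c := by
        intro u hu
        have h₁ := hsubset x y hxy hu
        rw [mem_branch]
        rw [mem_union, mem_pathVerts, mem_pathVerts] at h₁
        rcases h₁ with h₁ | h₁
        · exact hT.geodBetween_of_adj_root hc h₁.1 (hT.connected.geodBetween_trans hzc hzx.2).1 h₁.2
        · exact hT.geodBetween_of_adj_root hc h₁.1 (hT.connected.geodBetween_trans hzc hzy.2).1 h₁.2
      have h₁ := card_le_card hsub
      have h₂ := hM c hc.ne'
      omega
    have hsum : T.dist v x + T.dist v y = M + b := by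
      have h₁ := card_le_card (hsubset x y hxy)
      have h₂ := card_le_card (union_subset (hpath x hxL) (hpath y hyL))
      rw [card_union_of_disjoint hdisj, hT.card_pathVerts, hT.card_pathVerts] at h₁ h₂
      omega
    have hxM := hT.dist_le_of_card_branch_le hM x
    have hyM := hT.dist_le_of_card_branch_le hM y
    have hor : T.dist v x = M ∨ T.dist v y = M := by
      -- If `M ≤ b + 1`, two lengths at most `M` with sum `M + b` cannot both be below `M`.
      -- Otherwise the layer `b + 1` has `M - b - 1` members. That is too many for two disjoint
      -- branches, so some branch has at least `M` points, and it lies in a single arm.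
      by_cases hMb : M ≤ b + 1
      · omega
      have hc := hcount (b + 1) (by omega)
      obtain ⟨h₁, h₂, h₃, h₄, h₅⟩ := hT.laminar_branch_erase v w
      rcases card_large_laminar h₁ h₂ h₃ h₄ h₅ (b + 1) with h | ⟨u, hu, h⟩ | ⟨-, h⟩
      · rw [h, card_empty] at hc
        omega
      · rw [hc, herase u hu] at h
        have hu' := mem_others.1 hu
        have key : ∀ x y, (∀ z ∈ L, z = x ∨ z = y) → y ∉ T.branch v u → M ≤ T.dist v x := by
          intro x y hxy hy
          rw [← hT.card_pathVerts]
          refine le_trans (by omega) (card_le_card (s := T.branch v u) fun z hz => ?_)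
          have hzo := hsubo u hu hz
          obtain ⟨l, hl, hlz⟩ := hdown z hzo
          rcases hxy l hl with rfl | rfl
          · exact mem_pathVerts.2 ⟨(mem_others.1 hzo).1, mem_branch.1 hlz⟩
          · exact absurd (hT.connected.branch_subset hz hlz) hy
        by_cases hyu : y ∈ T.branch v u
        · right
          refine le_antisymm hyM (key y x (fun z hz => (hxy z hz).symm) fun hxu => ?_)
          rw [mem_branch] at hxu hyu
          exact Finset.disjoint_left.1 hdisj (mem_pathVerts.2 ⟨hu'.1, hxu⟩)
            (mem_pathVerts.2 ⟨hu'.1, hyu⟩)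
        · exact .inl (le_antisymm hxM (key x y hxy hyu))
      · omega
    rcases hor with h | h
    · exact ⟨x, y, h, by omega, hcover x y hxy⟩
    · exact ⟨y, x, h, by omega, hcover y x fun z hz => (hxy z hz).symm⟩

end SimpleGraph

/-! ### The path with a pendant vertex -/

section PendantPath

variable {m : ℕ} {p : Fin m}

@[simp] lemma pendantPath_adj_some_some {i j : Fin m} :
    (pendantPath m p).Adj (some i) (some j) ↔ i.val + 1 = j.val ∨ j.val + 1 = i.val := by
  rw [pendantPath, SimpleGraph.sup_adj, SimpleGraph.map_adj]
  simp [SimpleGraph.edge_adj, SimpleGraph.pathGraph_adj]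

@[simp] lemma pendantPath_adj_none_some {j : Fin m} :
    (pendantPath m p).Adj none (some j) ↔ j = p := by
  rw [pendantPath, SimpleGraph.sup_adj, SimpleGraph.map_adj]
  simp [SimpleGraph.edge_adj]

@[simp] lemma pendantPath_adj_some_none {j : Fin m} :
    (pendantPath m p).Adj (some j) none ↔ j = p := by
  rw [SimpleGraph.adj_comm, pendantPath_adj_none_some]

lemma pendantPath_connected (m : ℕ) (p : Fin m) : (pendantPath m p).Connected := by
  rw [SimpleGraph.connected_iff_exists_forall_reachable]
  refine ⟨some p, fun u => ?_⟩
  rcases u with _ | i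
  · exact SimpleGraph.Adj.reachable (by simp)
  · exact (SimpleGraph.pathGraph_preconnected m p i).map
      (⟨some, fun h => by simpa [SimpleGraph.pathGraph_adj] using h⟩ :
        SimpleGraph.pathGraph m →g pendantPath m p)

lemma pendantPath_isTree (m : ℕ) (p : Fin m) : (pendantPath m p).IsTree := by
  have hconn := pendantPath_connected m p
  rw [SimpleGraph.isTree_iff_connected_and_card]
  refine ⟨hconn, ?_⟩
  have h₁ := hconn.card_vert_le_card_edgeSet_add_one
  have hcard : Nat.card (Option (Fin m)) = m + 1 := by simp
  rw [hcard] at h₁ ⊢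
  -- The neighbour one step closer to `none`. Every edge joins some `some i` to its parent, so there
  -- are at most `m` edges.
  let par : Fin m → Option (Fin m) := fun i =>
    if h : i.val < p.val then some ⟨i.val + 1, by omega⟩
    else if i = p then none else some ⟨i.val - 1, by omega⟩
  have hsub : (pendantPath m p).edgeSet ⊆ Set.range fun i => s(some i, par i) := by
    have key : ∀ i j : Fin m, i.val + 1 = j.val →
        s(some i, some j) ∈ Set.range fun i => s(some i, par i) := by
      intro i j h
      by_cases hi : i.val < p.val
      · refine ⟨i, ?_⟩
        have : par i = some j := by simp only [par, hi, dite_true, h]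
        simp only [this]
      · refine ⟨j, ?_⟩
        have : par j = some i := by
          have h₁ : ¬ j.val < p.val := by omega
          have h₂ : j ≠ p := fun h' => by rw [h'] at h; omega
          simp only [par, h₁, h₂, dite_false, if_false, Option.some.injEq]
          exact Fin.ext (by simp only; omega)
        simp only [this, Sym2.eq_swap]
    have keyn : s(none, some p) ∈ Set.range fun i => s(some i, par i) :=
      ⟨p, by simp [par, Sym2.eq_swap]⟩
    intro e
    induction e using Sym2.ind with
    | _ a b =>
      rw [SimpleGraph.mem_edgeSet]
      intro h
      rcases a with _ | i <;> rcases b with _ | j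
      · exact absurd h ((pendantPath m p).irrefl)
      · rw [pendantPath_adj_none_some] at h
        rw [h]; exact keyn
      · rw [pendantPath_adj_some_none] at h
        rw [h, Sym2.eq_swap]; exact keyn
      · rw [pendantPath_adj_some_some] at h
        rcases h with h | h
        · exact key i j h
        · rw [Sym2.eq_swap]; exact key j i h
  have h₂ := Set.ncard_le_ncard hsub
  have h₃ : (Set.range fun i => s(some i, par i)).ncard ≤ m := by
    rw [← Set.image_univ]
    refine (Set.ncard_image_le Set.finite_univ).trans ?_
    simp [Set.ncard_univ]
  rw [← Nat.card_coe_set_eq] at h₂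
  omega

/-- Descending along `δ` bounds the distance from above; the Lipschitz condition bounds it from
below. -/
lemma SimpleGraph.Connected.dist_eq_of_potential {V : Type*} {G : SimpleGraph V}
    (hG : G.Connected) {a : V} {δ : V → ℕ} (h₀ : δ a = 0)
    (hlip : ∀ x y, G.Adj x y → δ y ≤ δ x + 1)
    (hdown : ∀ x ≠ a, ∃ y, G.Adj x y ∧ δ x = δ y + 1) (x : V) : G.dist a x = δ x := by
  apply le_antisymm
  · induction hd : δ x generalizing x with
    | zero =>
      by_cases hx : x = a
      · simp [hx]
      · obtain ⟨y, -, hy⟩ := hdown x hx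
        omega
    | succ d ih =>
      have hx : x ≠ a := by rintro rfl; omega
      obtain ⟨y, hadj, hy⟩ := hdown x hx
      have h₁ : G.dist a x ≤ G.dist a y + G.dist y x := hG.dist_triangle
      have h₂ : G.dist y x = 1 := SimpleGraph.dist_eq_one_iff_adj.2 hadj.symm
      have h₃ := ih y (by omega)
      omega
  · have key : ∀ {b c : V} (q : G.Walk b c), δ c ≤ δ b + q.length := by
      intro b c q
      induction q with
      | nil => simp
      | cons h q ih =>
        have := hlip _ _ h
        rw [SimpleGraph.Walk.length_cons]
        omega
    obtain ⟨q, hq⟩ := hG.exists_walk_length_eq_dist a x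
    have := key q
    omega

lemma pendantPath_dist_some (i : Fin m) (x : Option (Fin m)) :
    (pendantPath m p).dist (some i) x =
      x.elim ((i.val - p.val) + (p.val - i.val) + 1) fun j =>
        (i.val - j.val) + (j.val - i.val) := by
  refine (pendantPath_connected m p).dist_eq_of_potential
    (δ := fun x => x.elim ((i.val - p.val) + (p.val - i.val) + 1) fun j =>
        (i.val - j.val) + (j.val - i.val)) (by simp) ?_ ?_ x
  · rintro (_ | x) (_ | y) h
    · simp
    · rw [pendantPath_adj_none_some] at h
      subst h
      simp
      omega
    · rw [pendantPath_adj_some_none] at h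
      subst h
      simp
    · rw [pendantPath_adj_some_some] at h
      simp
      omega
  · rintro (_ | x) hx
    · exact ⟨some p, by simp⟩
    · rcases lt_trichotomy x.val i.val with h | h | h
      · refine ⟨some ⟨x.val + 1, by omega⟩, by simp, ?_⟩
        simp
        omega
      · exact absurd (congrArg some (Fin.ext h)) hx
      · refine ⟨some ⟨x.val - 1, by omega⟩, ?_, ?_⟩
        · rw [pendantPath_adj_some_some]
          simp only
          omega
        · simp
          omega

open Finset SimpleGraph

lemma pendantPath_card_branch_of_lt {i : Fin m} (h : i < p) :
    #((pendantPath m p).branch (some p) (some i)) = i.val + 1 := by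
  have : (pendantPath m p).branch (some p) (some i) = (Iic i).map Function.Embedding.some := by
    ext x
    rw [Fin.lt_def] at h
    rcases x with _ | j
    · have h₁ : none ∉ (Iic i).map Function.Embedding.some := by
        rw [mem_map]
        rintro ⟨j, -, hj⟩
        exact Option.some_ne_none j hj
      simp only [mem_branch, GeodBetween, pendantPath_dist_some, Option.elim, h₁, iff_false]
      omega
    · have h₁ : some j ∈ (Iic i).map Function.Embedding.some ↔ j ∈ Iic i := mem_map' _
      rw [h₁, mem_Iic, Fin.le_def]
      simp only [mem_branch, GeodBetween, pendantPath_dist_some, Option.elim]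
      omega
  rw [this, card_map, Fin.card_Iic]

lemma pendantPath_card_branch_of_gt {i : Fin m} (h : p < i) :
    #((pendantPath m p).branch (some p) (some i)) = m - i.val := by
  have : (pendantPath m p).branch (some p) (some i) = (Ici i).map Function.Embedding.some := by
    ext x
    rw [Fin.lt_def] at h
    rcases x with _ | j
    · have h₁ : none ∉ (Ici i).map Function.Embedding.some := by
        rw [mem_map]
        rintro ⟨j, -, hj⟩
        exact Option.some_ne_none j hj
      simp only [mem_branch, GeodBetween, pendantPath_dist_some, Option.elim, h₁, iff_false]
      omega
    · have h₁ : some j ∈ (Ici i).map Function.Embedding.some ↔ j ∈ Ici i := mem_map' _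
      rw [h₁, mem_Ici, Fin.le_def]
      simp only [mem_branch, GeodBetween, pendantPath_dist_some, Option.elim]
      omega
  rw [this, card_map, Fin.card_Ici]

lemma pendantPath_isLeafVertex : IsLeafVertex (pendantPath m p) none := by
  refine ⟨some p, by simp, ?_⟩
  rintro (_ | j) h
  · exact absurd h (pendantPath m p).irrefl
  · rw [pendantPath_adj_none_some.1 h]

lemma pendantPath_card_branch_none :
    #((pendantPath m p).branch (some p) none) = 1 := by
  rw [(pendantPath_isTree m p).branch_leaf pendantPath_isLeafVertex (by simp), card_singleton]

lemma pendantPath_steinerKDist {k : ℕ} (hk : 2 ≤ k) :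
    steinerKDist (pendantPath m p) k (some p) =
      (m - 1).choose (k - 2) + steinerWeightSum (m + 1) k p + steinerWeightSum (m + 1) k (m - 1 - p)
    := by
  classical
  have hcard : Fintype.card (Option (Fin m)) = m + 1 := by simp
  have hp := p.isLt
  set φ : ℕ → ℕ := fun i => if i < p.val then steinerWeight (m + 1) k (i + 1) else
    if i = p.val then 0 else steinerWeight (m + 1) k (m - i) with hφ
  have h₁ : ∀ i : Fin m, (if (some i : Option (Fin m)) ≠ some p then
      steinerWeight (m + 1) k #((pendantPath m p).branch (some p) (some i)) else 0) = φ i := by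
    intro i
    rcases lt_trichotomy i p with h | h | h
    · rw [if_pos (by simp [h.ne]), pendantPath_card_branch_of_lt h, hφ]
      simp only [Fin.lt_def.1 h, if_true]
    · simp [h, hφ]
    · have h' := Fin.lt_def.1 h
      rw [if_pos (by simp [h.ne']), pendantPath_card_branch_of_gt h, hφ]
      simp only [h'.not_gt, h'.ne', if_false]
  rw [(pendantPath_isTree m p).steinerKDist_eq hk, hcard, sum_filter, Fintype.sum_option,
    if_pos (by simp), pendantPath_card_branch_none, steinerWeight_one,
    show _ = ∑ i : Fin m, φ i from sum_congr rfl fun i _ => by convert h₁ i,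
    Fin.sum_univ_eq_sum_range φ m]
  have h₂ : ∑ i ∈ range m, φ i = ∑ i ∈ range p.val, φ i +
      (φ p + ∑ j ∈ range (m - 1 - p), φ (p + 1 + j)) := by
    rw [← sum_range_add_sum_Ico φ (show p.val ≤ m by omega), sum_Ico_eq_sum_range,
      show m - p.val = (m - 1 - p) + 1 by omega, sum_range_succ']
    simp only [add_zero, add_right_comm, add_assoc]
    rw [add_comm (φ p)]
  have h₃ : ∑ i ∈ range p.val, φ i = steinerWeightSum (m + 1) k p :=
    sum_congr rfl fun i hi => by simp [hφ, mem_range.1 hi]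
  have h₄ : ∑ j ∈ range (m - 1 - p), φ (p + 1 + j) = steinerWeightSum (m + 1) k (m - 1 - p) := by
    rw [steinerWeightSum, ← sum_range_reflect (fun j => steinerWeight (m + 1) k (j + 1))]
    refine sum_congr rfl fun j hj => ?_
    rw [mem_range] at hj
    simp only [hφ]
    rw [if_neg (by omega), if_neg (by omega)]
    congr 1
    omega
  rw [h₂, h₃, h₄, show φ p = 0 by simp [hφ], show m + 1 - 2 = m - 1 by omega]
  omega

end PendantPath

/-! ### Recognition of the extremal tree -/

namespace SimpleGraph

variable {V : Type*} {T : SimpleGraph V} [Fintype V]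

lemma IsTree.exists_iso_pendantPath (hT : T.IsTree) {v w x y : V} (hadj : T.Adj v w) {m : ℕ}
    {p : Fin m} (hm : Fintype.card V = m + 1) (hx : T.dist v x = p.val)
    (hy : T.dist v y = m - 1 - p.val)
    (hcover : ∀ u ≠ w, T.GeodBetween v u x ∨ T.GeodBetween v u y) :
    ∃ φ : T ≃g pendantPath m p, φ w = none := by
  obtain ⟨px, hpx, hlx⟩ := hT.connected.exists_path_of_dist v x
  obtain ⟨py, hpy, hly⟩ := hT.connected.exists_path_of_dist v y
  have hp := p.isLt
  let f : Option (Fin m) → V := fun a => a.elim w fun i =>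
    if i.val ≤ p.val then px.getVert (p.val - i.val) else py.getVert (i.val - p.val)
  have hsurj : Function.Surjective f := by
    intro u
    by_cases hu : u = w
    · exact ⟨none, hu.symm⟩
    rcases hcover u hu with h | h
    · obtain ⟨j, hj, hjl⟩ :=
        Walk.mem_support_iff_exists_getVert.1 (hT.mem_support_of_geodBetween h px)
      refine ⟨some ⟨p.val - j, by omega⟩, ?_⟩
      simp only [f, Option.elim_some]
      rw [if_pos (by omega), show p.val - (p.val - j) = j by omega, hj]
    · obtain ⟨j, hj, hjl⟩ :=
        Walk.mem_support_iff_exists_getVert.1 (hT.mem_support_of_geodBetween h py)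
      refine ⟨some ⟨p.val + j, by omega⟩, ?_⟩
      simp only [f, Option.elim_some]
      split_ifs with h'
      · have hj0 : j = 0 := by omega
        subst hj0
        rw [← hj]
        simp
      · rw [show p.val + j - p.val = j by omega, hj]
  have hbij : Function.Bijective f :=
    (Fintype.bijective_iff_surjective_and_card f).2 ⟨hsurj, by simp [hm]⟩
  have hstep : ∀ i j : Fin m, i.val + 1 = j.val → T.Adj (f (some i)) (f (some j)) := by
    intro i j h
    simp only [f, Option.elim_some]
    rcases lt_trichotomy i.val p.val with hi | hi | hi
    · rw [if_pos (by omega), if_pos (by omega), show p.val - i.val = p.val - j.val + 1 by omega]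
      exact (px.adj_getVert_succ (by omega)).symm
    · rw [if_pos (by omega), if_neg (by omega), hi, Nat.sub_self, Walk.getVert_zero,
        show j.val - p.val = 0 + 1 by omega]
      have := py.adj_getVert_succ (i := 0) (by omega)
      rwa [Walk.getVert_zero] at this
    · rw [if_neg (by omega), if_neg (by omega), show j.val - p.val = i.val - p.val + 1 by omega]
      exact py.adj_getVert_succ (by omega)
  have hfp : f (some p) = v := by simp [f]
  have hhom : ∀ a b, (pendantPath m p).Adj a b → T.Adj (f a) (f b) := by
    rintro (_ | i) (_ | j) h
    · exact absurd h (pendantPath m p).irrefl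
    · rw [pendantPath_adj_none_some.1 h, hfp]
      exact hadj.symm
    · rw [pendantPath_adj_some_none.1 h, hfp]
      exact hadj
    · rcases pendantPath_adj_some_some.1 h with h | h
      · exact hstep i j h
      · exact (hstep j i h).symm
  -- A tree is maximal among acyclic graphs, so the edge-preserving bijection `f` also reflects
  -- edges.
  have hmax := (isTree_iff_maximal_isAcyclic.1 (pendantPath_isTree m p)).2
  have hle : pendantPath m p ≤ T.comap f := fun a b h => hhom a b h
  have hge : T.comap f ≤ pendantPath m p :=
    hmax.2 (IsAcyclic.of_comap ⟨f, hbij.1⟩ hT.isAcyclic) hle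
  let e : pendantPath m p ≃g T :=
    ⟨Equiv.ofBijective f hbij, fun {a b} => ⟨fun h => hge h, fun h => hhom a b h⟩⟩
  refine ⟨e.symm, ?_⟩
  rw [RelIso.symm_apply_eq]
  rfl

end SimpleGraph

/-! ### Invariance under isomorphism, and the bound for the ratio -/

namespace SimpleGraph

open Finset

section Iso

variable {V W : Type*} {G : SimpleGraph V} {H : SimpleGraph W}

lemma Iso.dist_eq (φ : G ≃g H) (hG : G.Connected) (hH : H.Connected) (a b : V) :
    H.dist (φ a) (φ b) = G.dist a b := by
  apply le_antisymm
  · obtain ⟨p, hp⟩ := hG.exists_walk_length_eq_dist a b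
    rw [← hp, ← Walk.length_map φ.toHom p]
    exact dist_le _
  · obtain ⟨p, hp⟩ := hH.exists_walk_length_eq_dist (φ a) (φ b)
    rw [← hp, ← Walk.length_map φ.symm.toHom p]
    refine le_trans (le_of_eq ?_) (dist_le _)
    simp

variable [Fintype V] [Fintype W]

lemma Iso.steinerKDist_eq (φ : G ≃g H) (hG : G.IsTree) {k : ℕ} (hk : 2 ≤ k) (v : V) :
    steinerKDist H k (φ v) = steinerKDist G k v := by
  classical
  have hH : H.IsTree := φ.isTree_iff.1 hG
  have hd := φ.dist_eq hG.connected hH.connected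
  rw [hG.steinerKDist_eq hk, hH.steinerKDist_eq hk, ← Fintype.card_congr φ.toEquiv]
  rw [sum_filter, sum_filter]
  refine (Fintype.sum_equiv φ.toEquiv _ _ fun u => ?_).symm
  have hb : H.branch (φ v) (φ u) = (G.branch v u).map φ.toEquiv.toEmbedding := by
    ext z
    obtain ⟨z, rfl⟩ := φ.surjective z
    have h₁ : φ z ∈ (G.branch v u).map φ.toEquiv.toEmbedding ↔ z ∈ G.branch v u := mem_map' _
    rw [h₁, mem_branch, mem_branch, GeodBetween, GeodBetween, hd, hd, hd]
  have hne : φ u ≠ φ v ↔ u ≠ v := φ.injective.ne_iff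
  have hc : #(H.branch (φ v) (φ u)) = #(G.branch v u) := by rw [hb, card_map]
  change _ = if φ u ≠ φ v then steinerWeight _ k #(H.branch (φ v) (φ u)) else 0
  simp only [hne, hc]

lemma Iso.isLeafCentroidTree (φ : G ≃g H) {k : ℕ} (hk : 2 ≤ k) {w v : V}
    (h : IsLeafCentroidTree H k (φ w) (φ v)) : IsLeafCentroidTree G k w v := by
  have hG : G.IsTree := φ.isTree_iff.2 h.isTree
  refine ⟨hG, ?_, fun u => ?_⟩
  · obtain ⟨u, hu, huniq⟩ := h.isLeaf
    obtain ⟨u, rfl⟩ := φ.surjective u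
    exact ⟨u, φ.map_adj_iff.1 hu, fun y hy => φ.injective (huniq _ (φ.map_adj_iff.2 hy))⟩
  · rw [← φ.steinerKDist_eq hG hk, ← φ.steinerKDist_eq hG hk]
    exact h.isCentroid (φ u)

lemma Iso.steinerRatio_eq (φ : G ≃g H) (hG : G.IsTree) {k : ℕ} (hk : 2 ≤ k) (w v : V) :
    steinerRatio H k (φ w) (φ v) = steinerRatio G k w v := by
  rw [steinerRatio, steinerRatio, φ.steinerKDist_eq hG hk, φ.steinerKDist_eq hG hk]

end Iso

lemma Iso.isRatioMinimizer {X Y : Type} [Fintype X] [Fintype Y] {G : SimpleGraph X}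
    {H : SimpleGraph Y} (φ : G ≃g H) {k : ℕ} (hk : 2 ≤ k) {w v : X}
    (h : IsRatioMinimizer.{u} H k (φ w) (φ v)) : IsRatioMinimizer.{u} G k w v := by
  have hG := φ.isLeafCentroidTree hk h.1
  refine ⟨hG, ?_⟩
  rw [Fintype.card_congr φ.toEquiv, ← φ.steinerRatio_eq hG.isTree hk]
  exact h.2

lemma Iso.isUniqueRatioMinimizer {X Y : Type} [Fintype X] [Fintype Y] {G : SimpleGraph X}
    {H : SimpleGraph Y} (φ : G ≃g H) {k : ℕ} (hk : 2 ≤ k) {w v : X}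
    (h : IsUniqueRatioMinimizer.{u} H k (φ w) (φ v)) : IsUniqueRatioMinimizer.{u} G k w v := by
  have hG := φ.isRatioMinimizer hk h.1
  refine ⟨hG, fun V _ T w' v' hc hT heq => ?_⟩
  rw [Fintype.card_congr φ.toEquiv] at hc
  rw [← φ.steinerRatio_eq hG.1.isTree hk] at heq
  obtain ⟨ψ, hψ⟩ := h.2 V T w' v' hc hT heq
  refine ⟨ψ.trans φ.symm, ?_⟩
  rw [RelIso.trans_apply, hψ]
  simp

variable {V : Type*} {T : SimpleGraph V} [Fintype V]

lemma IsTree.steinerKDist_pos (hT : T.IsTree) {k : ℕ} (hk : 2 ≤ k) (hkn : k ≤ Fintype.card V)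
    (v : V) : 0 < steinerKDist T k v := by
  classical
  have : Nontrivial V := Fintype.one_lt_card_iff_nontrivial.1 (by omega)
  obtain ⟨u, hu⟩ := exists_ne v
  rw [hT.steinerKDist_eq hk]
  refine lt_of_lt_of_le ?_ (single_le_sum (fun _ _ => Nat.zero_le _)
    (show u ∈ ({u | u ≠ v} : Finset V) by simpa using hu))
  refine lt_of_lt_of_le ?_ (steinerWeight_mono (card_branch_pos v u))
  rw [Nat.succ_eq_add_one, zero_add, steinerWeight_one]
  exact Nat.choose_pos (by omega)

/-- For `k = n` a branch of any size has weight 1, so no tree is distinguished and uniqueness needs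
`k < n`. -/
lemma IsTree.steinerKDist_card (hT : T.IsTree) {k : ℕ} (hk : 2 ≤ k) (hkn : Fintype.card V = k)
    (v : V) : steinerKDist T k v = k - 1 := by
  classical
  have h : ∀ u ∈ ({u | u ≠ v} : Finset V), steinerWeight (Fintype.card V) k #(T.branch v u) = 1 := by
    intro u hu
    have h₁ := card_branch_pos (T := T) v u
    have h₂ := hT.connected.card_branch_lt (mem_filter.1 hu).2
    have h₃ := steinerWeight_add_choose (n := Fintype.card V) (k := k) (m := #(T.branch v u)) hk h₂
    rw [hkn, Nat.choose_self, Nat.choose_eq_zero_of_lt (by omega)] at h₃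
    rw [hkn]
    exact h₃
  rw [hT.steinerKDist_eq hk, sum_congr rfl h, sum_const, smul_eq_mul, mul_one,
    filter_ne', card_erase_of_mem (mem_univ v), card_univ, hkn]

lemma IsTree.steinerRatio_card (hT : T.IsTree) {k : ℕ} (hk : 2 ≤ k) (hkn : Fintype.card V = k)
    (w v : V) : steinerRatio T k w v = 1 := by
  have : ((k - 1 : ℕ) : ℝ) ≠ 0 := Nat.cast_ne_zero.2 (by omega)
  rw [steinerRatio, hT.steinerKDist_card hk hkn, hT.steinerKDist_card hk hkn, div_self this]

/-- The lower bound for the ratio, and the structure of the trees that attain it. -/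
lemma steinerRatio_bound {k m M b : ℕ} (hk : 2 ≤ k) (hkn : k < Fintype.card V) {w v : V}
    (h : IsLeafCentroidTree T k w v) (hM : M = max (Fintype.card V / 2) (k - 1))
    (hn : M + b + 2 = Fintype.card V) :
    1 + ((Fintype.card V - 2).choose (k - 1) : ℝ) / (steinerF k M b : ℝ) ≤ steinerRatio T k w v ∧
    (steinerRatio T k w v = 1 + ((Fintype.card V - 2).choose (k - 1) : ℝ) / (steinerF k M b : ℝ) →
      ∀ p : Fin m, Fintype.card V = m + 1 → p.val = M → ∃ φ : T ≃g pendantPath m p, φ w = none) := by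
  classical
  obtain ⟨hT, hw, hv⟩ := h
  -- Replacing `v` by the centroid nearest to `w` leaves the ratio unchanged.
  obtain ⟨c, hc, hpos⟩ := hT.exists_nearest_centroid hk hv w
  have hdc : steinerKDist T k v = steinerKDist T k c := le_antisymm (hv c) (hc v)
  have hcM := (hT.isSteinerCentroid_iff hk c).1 hc
  rw [← hM] at hcM
  have hcw := hT.leaf_ne_centroid hk hkn hc hw
  obtain ⟨h₁, h₂⟩ := hT.leaf_dist_bound hk hkn hw hcw hcM hpos hn rfl
  have hF := steinerF_eq (n := Fintype.card V) (k := k) (a := M) (b := b) hk hn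
  have hFpos : 0 < (Fintype.card V - 2).choose (k - 2) + steinerWeightSum (Fintype.card V) k M +
      steinerWeightSum (Fintype.card V) k b := by
    have : 0 < (Fintype.card V - 2).choose (k - 2) := Nat.choose_pos (by omega)
    omega
  have hd := hT.steinerKDist_pos hk hkn.le c
  rw [steinerRatio, hdc]
  have hFc : (steinerF k M b : ℝ) = (((Fintype.card V - 2).choose (k - 2) +
      steinerWeightSum (Fintype.card V) k M + steinerWeightSum (Fintype.card V) k b : ℕ) : ℝ) := by
    rw [hF]
    push_cast
    ring
  rw [hFc]
  set F := (Fintype.card V - 2).choose (k - 2) +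
      steinerWeightSum (Fintype.card V) k M + steinerWeightSum (Fintype.card V) k b with hFdef
  have hd' : (0 : ℝ) < steinerKDist T k c := by exact_mod_cast hd
  have hF' : (0 : ℝ) < (F : ℝ) := by exact_mod_cast hFpos
  have e₁ : (steinerKDist T k w : ℝ) / steinerKDist T k c =
      1 + ((steinerKDist T k w : ℝ) - steinerKDist T k c) / steinerKDist T k c := by
    field_simp
    ring
  rw [e₁]
  constructor
  · rw [add_le_add_iff_left, div_le_div_iff₀ hF' hd']
    have : (((Fintype.card V - 2).choose (k - 1) : ℤ) * steinerKDist T k c : ℝ) ≤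
      (F : ℤ) * (((steinerKDist T k w : ℤ) : ℝ) - (steinerKDist T k c : ℤ)) := by exact_mod_cast h₁
    push_cast at this
    linarith
  · intro heq p hm hp
    rw [add_right_inj, div_eq_div_iff hd'.ne' hF'.ne'] at heq
    have h₃ : ((Fintype.card V - 2).choose (k - 1) : ℤ) * steinerKDist T k c =
        F * ((steinerKDist T k w : ℤ) - steinerKDist T k c) := by
      have : (((Fintype.card V - 2).choose (k - 1) : ℤ) * steinerKDist T k c : ℝ) =
        (F : ℤ) * (((steinerKDist T k w : ℤ) : ℝ) - (steinerKDist T k c : ℤ)) := by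
          push_cast
          linarith
      exact_mod_cast this
    obtain ⟨hadj, hsum⟩ := h₂ h₃
    obtain ⟨x, y, hx, hy, hcover⟩ := hT.exists_two_paths hk hkn hw hadj hcM hM hn hsum
    exact hT.exists_iso_pendantPath hadj hm (hx.trans hp.symm) (by omega) hcover

end SimpleGraph

/-! ### The minimizing trees -/

section Extremal

open SimpleGraph

variable {n k m b : ℕ} {p : Fin m}

lemma pendantPath_isLeafCentroidTree (hk : 2 ≤ k) (hp : p.val = max ((m + 1) / 2) (k - 1)) :
    IsLeafCentroidTree (pendantPath m p) k none (some p) := by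
  have hT := pendantPath_isTree m p
  refine ⟨hT, pendantPath_isLeafVertex, ?_⟩
  rw [hT.isSteinerCentroid_iff hk]
  have hcard : Fintype.card (Option (Fin m)) = m + 1 := by simp
  rw [hcard, ← hp]
  have := p.isLt
  rintro (_ | i) hu
  · rw [pendantPath_card_branch_none]
    omega
  · rcases lt_trichotomy i p with h | h | h
    · rw [pendantPath_card_branch_of_lt h]
      exact h
    · exact absurd (congrArg some h) hu
    · rw [pendantPath_card_branch_of_gt h]
      rw [Fin.lt_def] at h
      omega

lemma pendantPath_steinerRatio (hk : 2 ≤ k) (hkn : k < n) (hm : m + 1 = n)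
    (hb : p.val + b + 2 = n) :
    steinerRatio (pendantPath m p) k none (some p) =
      1 + ((n - 2).choose (k - 1) : ℝ) / (steinerF k p.val b : ℝ) := by
  have hT := pendantPath_isTree m p
  have hcard : Fintype.card (Option (Fin m)) = m + 1 := by simp
  have h₁ := hT.steinerKDist_sub_of_adj hk (v := some p) (x := none) (by simp)
  rw [pendantPath_card_branch_none, steinerGain_one hk, hcard] at h₁
  have h₂ := pendantPath_steinerKDist (m := m) (p := p) hk
  have h₃ : (steinerF k p.val b : ℤ) = steinerKDist (pendantPath m p) k (some p) := by
    rw [h₂, steinerF_eq hk hb, ← hm, show m + 1 - 2 = m - 1 by omega, show m - 1 - p.val = b by omega]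
    push_cast
    ring
  have h₄ : (0 : ℝ) < steinerKDist (pendantPath m p) k (some p) := by
    exact_mod_cast hT.steinerKDist_pos hk (by omega) _
  have h₅ : (steinerKDist (pendantPath m p) k none : ℝ) =
      steinerKDist (pendantPath m p) k (some p) + ((n - 2).choose (k - 1) : ℝ) := by
    rw [← hm]
    have : (steinerKDist (pendantPath m p) k none : ℤ) =
      steinerKDist (pendantPath m p) k (some p) + ((m + 1 - 2).choose (k - 1) : ℤ) := by omega
    exact_mod_cast this
  rw [h₃, steinerRatio, h₅, add_div, Int.cast_natCast, div_self h₄.ne']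

lemma isRatioLowerBound_steinerF (hk : 2 ≤ k) (hkn : k < n) {M : ℕ}
    (hM : M = max (n / 2) (k - 1)) (hb : M + b + 2 = n) :
    IsRatioLowerBound.{u} n k (1 + ((n - 2).choose (k - 1) : ℝ) / (steinerF k M b : ℝ)) := by
  intro V _ T w v hc h
  subst hc
  exact (steinerRatio_bound (m := 0) hk hkn h hM hb).1

lemma isRatioLowerBound_card (hk : 2 ≤ k) {c : ℝ} (hc : c ≤ 1) :
    IsRatioLowerBound.{u} k k c := by
  intro V _ T w v hn h
  rwa [h.isTree.steinerRatio_card hk hn]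

lemma pendantPath_isUniqueRatioMinimizer (hk : 2 ≤ k) (hkn : k < n) (hm : m + 1 = n)
    (hp : p.val = max (n / 2) (k - 1)) :
    IsUniqueRatioMinimizer.{u} (pendantPath m p) k none (some p) := by
  subst hm
  have hcard : Fintype.card (Option (Fin m)) = m + 1 := by simp
  have := p.isLt
  obtain ⟨b, hb⟩ : ∃ b, p.val + b + 2 = m + 1 := ⟨m - 1 - p.val, by omega⟩
  have hr := pendantPath_steinerRatio hk hkn rfl hb
  refine ⟨⟨pendantPath_isLeafCentroidTree hk hp, ?_⟩, ?_⟩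
  · rw [hr, hcard]
    exact isRatioLowerBound_steinerF hk hkn hp hb
  · intro V _ T w v hc h heq
    rw [hcard] at hc
    rw [hr, ← hc] at heq
    rw [← hc] at hp hb hkn
    exact (steinerRatio_bound hk hkn h hp hb).2 heq p hc rfl

lemma exists_iso_pathGraph_pendantPath (hm : m + 1 = n) (hp : p.val + 1 = m) :
    ∃ φ : pathGraph n ≃g pendantPath m p, φ ⟨0, by omega⟩ = none ∧ φ ⟨1, by omega⟩ = some p := by
  subst hm
  -- The end `0` becomes the pendant vertex, and the rest is reversed so that vertex `1` lands on `p
  -- = m - 1`.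
  let e : Fin (m + 1) ≃ Option (Fin m) := (finSuccEquiv m).trans (Equiv.optionCongr Fin.revPerm)
  have e₀ : e 0 = none := by simp [e]
  have es : ∀ i : Fin m, e i.succ = some i.rev := fun i => by simp [e]
  have hz : ∀ i : Fin m, i.rev = p ↔ i.val = 0 := by
    intro i
    rw [Fin.ext_iff, Fin.val_rev]
    omega
  refine ⟨⟨e, ?_⟩, e₀, ?_⟩
  · intro i j
    refine Fin.cases ?_ (fun i => ?_) i <;> refine Fin.cases ?_ (fun j => ?_) j
    · simp
    · rw [e₀, es, pendantPath_adj_none_some, hz, pathGraph_adj]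
      simp
    · rw [e₀, es, pendantPath_adj_some_none, hz, pathGraph_adj]
      simp
    · rw [es, es, pendantPath_adj_some_some, pathGraph_adj, Fin.val_rev, Fin.val_rev]
      simp
      omega
  · have h0 : 0 < m := by omega
    change e (⟨0, h0⟩ : Fin m).succ = _
    rw [es, (hz _).2 rfl]

end Extremal

lemma pathGraph_steinerRatio {n k : ℕ} (hk : 2 ≤ k) (hkn : k + 1 = n) :
    1 + ((n - 2).choose (k - 1) : ℝ) / (steinerF k (n - 2 : ℕ) (0 : ℕ) : ℝ) =
      1 + ((n - 2).choose (k - 1) : ℝ) / (2 * ((n : ℝ) - 2) + ((n : ℝ) - 3) * ((n : ℝ) - 1)) := by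
  obtain ⟨j, rfl⟩ := Nat.exists_eq_add_of_le' hk
  subst hkn
  have h₁ := steinerF_eq (n := j + 2 + 1) (k := j + 2) (a := j + 2 + 1 - 2) (b := 0) hk (by omega)
  have h₂ := steinerWeightSum_add_choose (n := j + 2 + 1) (k := j + 2) (a := j + 2 + 1 - 2) hk
    (by omega)
  have e₁ : j + 2 + 1 - 2 = j + 1 := by omega
  have e₂ : j + 2 + 1 - 1 = j + 2 := by omega
  have e₃ : j + 2 - 1 = j + 1 := by omega
  have e₄ : j + 2 - (j + 1) = 1 := by omega
  have e₅ : j + 2 - 2 = j := by omega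
  rw [e₁, e₂, e₃, e₄, Nat.choose_self, Nat.choose_eq_zero_of_lt (show 1 < j + 2 by omega),
    Nat.choose_succ_self_right] at h₂
  rw [e₁, e₅, Nat.choose_succ_self_right, steinerWeightSum, steinerWeightSum, Finset.sum_range_zero,
    ← steinerWeightSum] at h₁
  rw [e₁, h₁]
  congr 2
  have h₃ : (steinerWeightSum (j + 2 + 1) (j + 2) (j + 1) : ℝ) + 1 = (j + 1) * (j + 1 + 1) + 0 := by
    exact_mod_cast h₂
  push_cast
  linarith


/-! ### The main theorem -/

theorem mainTheorem4 (n k : ℕ) (hk : 2 ≤ k) (hkn : k ≤ n) :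
    -- `k ≥ n - 1`
    (∀ _ : n ≤ k + 1,
      IsRatioMinimizer.{u} (SimpleGraph.pathGraph n) k ⟨0, by omega⟩ ⟨1, by omega⟩ ∧
      (k < n →
        IsUniqueRatioMinimizer.{u} (SimpleGraph.pathGraph n) k ⟨0, by omega⟩ ⟨1, by omega⟩) ∧
      (k = n →
        IsRatioLowerBound.{u} n k (1 + ((n - 2).choose (k - 1) : ℝ) / ((n : ℝ) - 1)) ∧
        steinerRatio (SimpleGraph.pathGraph n) k ⟨0, by omega⟩ ⟨1, by omega⟩ =
          1 + ((n - 2).choose (k - 1) : ℝ) / ((n : ℝ) - 1)) ∧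
      (k + 1 = n →
        IsRatioLowerBound.{u} n k (1 + ((n - 2).choose (k - 1) : ℝ) /
          (2 * ((n : ℝ) - 2) + ((n : ℝ) - 3) * ((n : ℝ) - 1))) ∧
        steinerRatio (SimpleGraph.pathGraph n) k ⟨0, by omega⟩ ⟨1, by omega⟩ =
          1 + ((n - 2).choose (k - 1) : ℝ) /
            (2 * ((n : ℝ) - 2) + ((n : ℝ) - 3) * ((n : ℝ) - 1)))) ∧
    -- `n` even and `k ≤ n / 2 + 1`
    (∀ _ : n % 2 = 0, 2 * k ≤ n + 2 →
      IsRatioLowerBound.{u} n k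
        (1 + ((n - 2).choose (k - 1) : ℝ) / (steinerF k ((n : ℤ) / 2) ((n : ℤ) / 2 - 2) : ℝ)) ∧
      ∀ _ : k < n,
        IsUniqueRatioMinimizer.{u} (pendantPath (n - 1) ⟨n / 2, by omega⟩) k
          none (some ⟨n / 2, by omega⟩) ∧
        steinerRatio (pendantPath (n - 1) ⟨n / 2, by omega⟩) k none (some ⟨n / 2, by omega⟩) =
          1 + ((n - 2).choose (k - 1) : ℝ) /
            (steinerF k ((n : ℤ) / 2) ((n : ℤ) / 2 - 2) : ℝ)) ∧
    -- `n` odd and `k ≤ n / 2 + 1`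
    (∀ _ : n % 2 = 1, 2 * k ≤ n + 2 →
      IsRatioLowerBound.{u} n k
        (1 + ((n - 2).choose (k - 1) : ℝ) /
          (steinerF k (((n : ℤ) - 1) / 2) (((n : ℤ) - 3) / 2) : ℝ)) ∧
      ∀ _ : k < n,
        IsUniqueRatioMinimizer.{u} (pendantPath (n - 1) ⟨(n - 1) / 2, by omega⟩) k
          none (some ⟨(n - 1) / 2, by omega⟩) ∧
        steinerRatio (pendantPath (n - 1) ⟨(n - 1) / 2, by omega⟩) k
            none (some ⟨(n - 1) / 2, by omega⟩) =
          1 + ((n - 2).choose (k - 1) : ℝ) /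
            (steinerF k (((n : ℤ) - 1) / 2) (((n : ℤ) - 3) / 2) : ℝ)) ∧
    -- `k > n / 2 + 1`
    (n + 2 < 2 * k →
      IsRatioLowerBound.{u} n k
        (1 + ((n - 2).choose (k - 1) : ℝ) /
          (steinerF k ((k : ℤ) - 1) ((n : ℤ) - (k : ℤ) - 1) : ℝ)) ∧
      ∀ _ : k < n,
        IsUniqueRatioMinimizer.{u} (pendantPath (n - 1) ⟨k - 1, by omega⟩) k
          none (some ⟨k - 1, by omega⟩) ∧
        steinerRatio (pendantPath (n - 1) ⟨k - 1, by omega⟩) k none (some ⟨k - 1, by omega⟩) =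
          1 + ((n - 2).choose (k - 1) : ℝ) /
            (steinerF k ((k : ℤ) - 1) ((n : ℤ) - (k : ℤ) - 1) : ℝ)) := by
  -- For `k = n` the numerator vanishes, so each bound is 1 whatever its denominator, including a
  -- `steinerF` with second argument `-1`.
  have hcn : k = n → ((n - 2).choose (k - 1) : ℝ) = 0 := by
    intro h
    rw [Nat.choose_eq_zero_of_lt (by omega), Nat.cast_zero]
  have hlow : ∀ c : ℝ, k = n → IsRatioLowerBound.{u} n k
      (1 + ((n - 2).choose (k - 1) : ℝ) / c) := by
    intro c h
    rw [hcn h, zero_div, add_zero]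
    subst h
    exact isRatioLowerBound_card hk le_rfl
  -- Items 2 to 4 differ only in the closed form of `M` and `b`; the integer arguments `x` and `y`
  -- absorb this.
  have hcase : ∀ (M b : ℕ), M = max (n / 2) (k - 1) → M + b + 2 = n → ∀ x y : ℤ, x = M → y = b →
      ∀ p : Fin (n - 1), p.val = M → k < n →
      IsRatioLowerBound.{u} n k (1 + ((n - 2).choose (k - 1) : ℝ) / (steinerF k x y : ℝ)) ∧
      IsUniqueRatioMinimizer.{u} (pendantPath (n - 1) p) k none (some p) ∧
      steinerRatio (pendantPath (n - 1) p) k none (some p) =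
        1 + ((n - 2).choose (k - 1) : ℝ) / (steinerF k x y : ℝ) := by
    rintro M b hM hb x y rfl rfl p hp hkn
    refine ⟨isRatioLowerBound_steinerF hk hkn hM hb,
      pendantPath_isUniqueRatioMinimizer hk hkn (by omega) (hp.trans hM), ?_⟩
    rw [← hp] at hb ⊢
    exact pendantPath_steinerRatio hk hkn (by omega) hb
  refine ⟨fun hn => ?_, fun hn hk2 => ?_, fun hn hk2 => ?_, fun hk2 => ?_⟩
  · obtain ⟨φ, h₀, h₁⟩ := exists_iso_pathGraph_pendantPath (n := n) (m := n - 1)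
      (p := ⟨n - 2, by omega⟩) (by omega) (by simp only; omega)
    have huniq : k < n → IsUniqueRatioMinimizer.{u} (SimpleGraph.pathGraph n) k
        ⟨0, by omega⟩ ⟨1, by omega⟩ := by
      intro hkn
      refine φ.isUniqueRatioMinimizer hk ?_
      rw [h₀, h₁]
      exact pendantPath_isUniqueRatioMinimizer hk hkn (by omega) (by simp only; omega)
    have htree : (SimpleGraph.pathGraph n).IsTree :=
      φ.isTree_iff.2 (pendantPath_isTree _ _)
    have hcard : Fintype.card (Fin n) = n := Fintype.card_fin n
    have hratio : k = n → steinerRatio (SimpleGraph.pathGraph n) k ⟨0, by omega⟩ ⟨1, by omega⟩ = 1 :=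
      fun h => htree.steinerRatio_card hk (hcard.trans h.symm) _ _
    refine ⟨?_, huniq, fun h => ⟨hlow _ h, ?_⟩, fun h => ?_⟩
    · rcases hkn.lt_or_eq with h | h
      · exact (huniq h).1
      · refine ⟨φ.isLeafCentroidTree hk ?_, ?_⟩
        · rw [h₀, h₁]
          have hT := pendantPath_isTree (n - 1) ⟨n - 2, by omega⟩
          have hc : Fintype.card (Option (Fin (n - 1))) = k := by
            rw [Fintype.card_option, Fintype.card_fin]
            omega
          refine ⟨hT, pendantPath_isLeafVertex, fun u => ?_⟩
          rw [hT.steinerKDist_card hk hc, hT.steinerKDist_card hk hc]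
        · rw [hratio h, hcard, ← h]
          exact isRatioLowerBound_card hk le_rfl
    · rw [hratio h, hcn h, zero_div, add_zero]
    -- For `k = n - 1` the maximum is `n - 2`, so `b = 0` and the pendant path is a path.
    · have hM : n - 2 = max (n / 2) (k - 1) := by omega
      rw [← pathGraph_steinerRatio hk h]
      refine ⟨isRatioLowerBound_steinerF hk (by omega) hM (by omega), ?_⟩
      rw [← φ.steinerRatio_eq htree hk, h₀, h₁]
      exact pendantPath_steinerRatio hk (by omega) (by omega) (by simp only; omega)
  · rcases hkn.lt_or_eq with h | h
    · obtain ⟨r₁, r₂⟩ := hcase (n / 2) (n / 2 - 2) (by omega) (by omega) ((n : ℤ) / 2)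
        ((n : ℤ) / 2 - 2) (by omega) (by omega) ⟨n / 2, by omega⟩ rfl h
      exact ⟨r₁, fun _ => r₂⟩
    · exact ⟨hlow _ h, fun h' => absurd h h'.ne⟩
  · rcases hkn.lt_or_eq with h | h
    · obtain ⟨r₁, r₂⟩ := hcase ((n - 1) / 2) ((n - 3) / 2) (by omega) (by omega)
        (((n : ℤ) - 1) / 2) (((n : ℤ) - 3) / 2) (by omega) (by omega) ⟨(n - 1) / 2, by omega⟩ rfl h
      exact ⟨r₁, fun _ => r₂⟩
    · exact ⟨hlow _ h, fun h' => absurd h h'.ne⟩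
  · rcases hkn.lt_or_eq with h | h
    · obtain ⟨r₁, r₂⟩ := hcase (k - 1) (n - k - 1) (by omega) (by omega)
        ((k : ℤ) - 1) ((n : ℤ) - (k : ℤ) - 1) (by omega) (by omega) ⟨k - 1, by omega⟩ rfl h
      exact ⟨r₁, fun _ => r₂⟩
    · exact ⟨hlow _ h, fun h' => absurd h h'.ne⟩
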